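/- Let $k$ be a field of characteristic $w\ge 0$, $X$ a normal $k$-variety (integral, separated and of finite type over $k$) with function field $K(X)$, and $$D=\sum_V \frac{p_V}{q_V}\,V$$ a $\mathbb{Q}$-divisor on $X$: a finite sum over prime Weil divisors $V$ with non-zero coefficients written in lowest terms, $q_V>0$. For a $\mathbb{Q}$-divisor $S$ let $\mathcal{O}_X(S)=\mathcal{O}_X(\lfloor S\rfloor)$, the sheaf of rational functions $f$ with $\operatorname{ord}_V f\ge -\lfloor S_V\rfloor$ for all $V$. Let $T$ be an indeterminate, $\mathcal{A}=\bigoplus_{i\in\mathbb{Z}}\mathcal{O}_X(iD)T^i\subset K(X)[T,T^{-1}]$, $\pi\colon C=\operatorname{Spec}_X\mathcal{A}\to X$, and for $d\in\mathbb{Z}$ let $(\pi_*\Theta_C)_d$ be the $\mathcal{O}_X$-module of $k$-linear derivations of the sheaf of algebras $\pi_*\mathcal{O}_C=\mathcal{A}$ that are homogeneous of degree $d$. Put $$W_{D,d}=\sum_{p_Vd\equiv-1\bmod q_V\ \text{and}\ w\mid q_V}V,\qquad L_{D,d}=\sum_{p_Vd\not\equiv-1\bmod q_V\ \text{or}\ w\mid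 q_V}V,$$ where $V$ runs over the components of $D$, and let $\mathcal{D}er_X(S-\log L)$ be the sheaf of those $k$-linear derivations $\sigma$ of $K(X)$ with $\sigma(\mathcal{O}_X(-L))\subset\mathcal{O}_X(S-L)$. Let $U=\operatorname{Spec}B$ be an affine open subset of $X$ on which every component $V$ of $D$ is Cartier (locally principal). Every section $\delta$ of $(\pi_*\Theta_C)_d$ over a non-empty open subset of $U$ can be written uniquely as $\delta=T^d(\sigma+\alpha\,T\partial_T)$, where $\sigma$ is a $k$-linear derivation of $K(X)$, extended by $\sigma(T)=0$, and $\alpha\in K(X)$. The assignments $\varphi_U(\alpha)=\alpha T^d\,T\partial_T$ and $\psi_U(\delta)=\sigma$ define morphisms of $\mathcal{O}_U$-modules, and the sequence $$0\to\mathcal{O}_U(dD+W_{D,d})\xrightarrow{\ \varphi_U\ }(\pi_*\Theta_C)_d|_U\xrightarrow{\ \psi_U\ }\mathcal{D}er_U(dD-\log L_{D,d})\to0$$ is exact. Moreover $\psi_U$ is surjective on sections over every affine open subset of $U$. -/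

import Mathlib

open AlgebraicGeometry CategoryTheory Order
open scoped LaurentPolynomial

universe u

namespace EulerSeq

noncomputable section

/-! ### Normal schemes over a field and their function fields -/

/-- A scheme is normal if all its local rings are integrally closed. -/
class IsNormalScheme (X : Scheme.{u}) : Prop where
  isIntegrallyClosed_stalk (x : X) : IsIntegrallyClosed (X.presheaf.stalk x)

/-- The function field of an integral scheme over `Spec k` is a `k`-algebra through
`k → Γ(X, ⊤) → K(X)`. -/
instance functionFieldAlgebra (k : Type u) [Field k] (X : Scheme.{u}) [IsIntegral X]
    [X.Over (Spec (.of k))] : Algebra k X.functionField :=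
  ((X.presheaf.germ ⊤ (genericPoint X) trivial).hom.comp
    ((X ↘ Spec (.of k)).appTop.hom.comp (Scheme.ΓSpecIso (.of k)).inv.hom)).toAlgebra

instance smulCommClass_sections (k : Type u) [Field k] (X : Scheme.{u}) [IsIntegral X]
    [X.Over (Spec (.of k))] (W : X.Opens) [Nonempty W] :
    SMulCommClass k Γ(X, W) X.functionField where
  smul_comm a b c := by
    simp only [Algebra.smul_def]
    ring

instance smulCommClass_sections_field (X : Scheme.{u}) [IsIntegral X]
    (W : X.Opens) [Nonempty W] : SMulCommClass Γ(X, W) X.functionField X.functionField where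
  smul_comm a b c := by
    simp only [Algebra.smul_def]
    ring

lemma algebraMap_restrict {X : Scheme.{u}} [IsIntegral X] {W₁ W₂ : X.Opens} [Nonempty W₁]
    [Nonempty W₂] (h : W₁ ≤ W₂) (a : Γ(X, W₂)) :
    algebraMap Γ(X, W₁) X.functionField (X.presheaf.map (homOfLE h).op a) =
      algebraMap Γ(X, W₂) X.functionField a :=
  X.presheaf.germ_res_apply (homOfLE h) (genericPoint X) _ a

section Divisors

variable (X : Scheme.{u})

/-- Prime Weil divisors, given by their generic points: the points of codimension one. -/
abbrev PrimeDivisor : Type u := {x : X // coheight x = 1}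

/-- `ℚ`-divisors: finite formal sums of prime divisors with rational coefficients. -/
abbrev QDivisor : Type u := PrimeDivisor X →₀ ℚ

end Divisors

/-- The nonempty open subsets of an open subset `W`. -/
abbrev OpensIn {X : Scheme.{u}} (W : X.Opens) : Type u :=
  {W' : X.Opens // Nonempty W' ∧ W' ≤ W}

instance {X : Scheme.{u}} {W : X.Opens} (W' : OpensIn W) : Nonempty W'.1 := W'.2.1

/-- A nonempty open subset of an open subset of `W`, as an open subset of `W`. -/
abbrev OpensIn.mono {X : Scheme.{u}} {W₁ W₂ : X.Opens} (h : W₁ ≤ W₂) (W' : OpensIn W₁) :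
    OpensIn W₂ := ⟨W'.1, W'.2.1, W'.2.2.trans h⟩

section Sheaves

variable {X : Scheme.{u}} [IsIntegral X] [IsLocallyNoetherian X]

/-- A prime divisor `V` is Cartier on the open subset `U` if it is locally principal there: each
point of `U` has an open neighbourhood on which `V` is the divisor of a rational function. -/
def IsCartierOn (V : PrimeDivisor X) (U : X.Opens) : Prop :=
  ∀ x ∈ U, ∃ W : X.Opens, x ∈ W ∧ ∃ g : X.functionField, g ≠ 0 ∧
    ∀ y : PrimeDivisor X, y.1 ∈ W →
      (y = V → Scheme.ord g y.1 = 1) ∧ (y ≠ V → Scheme.ord g y.1 = 0)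

lemma isDiscreteValuationRing_stalk [IsNormalScheme X] {x : X} (hx : coheight x = 1) :
    IsDiscreteValuationRing (X.presheaf.stalk x) := by
  have hic := IsNormalScheme.isIntegrallyClosed_stalk x
  have hdim : ringKrullDim (X.presheaf.stalk x) = 1 := by
    rw [ringKrullDim_stalk_eq_coheight, hx]; rfl
  have hK : Ring.KrullDimLE 1 (X.presheaf.stalk x) := krullDimLE_of_coheight_le hx.le
  have hnf : ¬ IsField (X.presheaf.stalk x) := by
    intro h
    rw [ringKrullDim_eq_zero_of_isField h] at hdim
    exact zero_ne_one hdim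
  have hdd : IsDedekindDomain (X.presheaf.stalk x) :=
    { toIsDomain := inferInstance
      toIsDedekindRing :=
        { toIsNoetherian := inferInstance
          toDimensionLEOne :=
            ⟨fun {p} hp hpp => Ring.krullDimLE_one_iff_of_noZeroDivisors.mp hK p hp hpp⟩
          toIsIntegralClosure := hic } }
  exact ((IsDiscreteValuationRing.TFAE (X.presheaf.stalk x) hnf).out 0 2).mpr hdd

/-- The rational functions `f` on `W` with `ord_V f ≥ -⌊S_V⌋` for all prime divisors `V` that
meet `W`. -/
def sectionsAdd [IsNormalScheme X] (S : QDivisor X) (W : X.Opens) :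
    AddSubgroup X.functionField where
  carrier := {f | ∀ V : PrimeDivisor X, V.1 ∈ W → f ≠ 0 → -⌊S V⌋ ≤ Scheme.ord f V.1}
  zero_mem' := fun _ _ h => (h rfl).elim
  add_mem' := by
    intro f g hf hg V hV hfg
    have := isDiscreteValuationRing_stalk V.2
    by_cases hf0 : f = 0
    · subst hf0
      simp only [zero_add] at hfg ⊢
      exact hg V hV hfg
    by_cases hg0 : g = 0
    · subst hg0
      simp only [add_zero] at hfg ⊢
      exact hf V hV hfg
    exact (le_min (hf V hV hf0) (hg V hV hg0)).trans (Scheme.ord_add hfg)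
  neg_mem' := by
    intro f hf V hV hf0
    have h1 : (-1 : X.functionField) ≠ 0 := neg_ne_zero.mpr one_ne_zero
    have h : Scheme.ord (-1 : X.functionField) V.1 = 0 := by
      have h2 := Scheme.ord_mul (x := V.1) h1 h1
      have h3 := Scheme.ord_mul (x := V.1) (one_ne_zero (α := X.functionField)) one_ne_zero
      simp only [mul_neg, mul_one, neg_neg] at h2 h3
      omega
    have hf1 : f ≠ 0 := neg_ne_zero.mp hf0
    rw [← neg_one_mul f, Scheme.ord_mul h1 hf1, h, zero_add]
    exact hf V hV hf1

lemma smul_mem_sectionsAdd [IsNormalScheme X] (S : QDivisor X) (W : X.Opens) [Nonempty W]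
    (a : Γ(X, W)) {f : X.functionField} (hf : f ∈ sectionsAdd S W) :
    a • f ∈ sectionsAdd S W := by
  intro V hV h0
  have ha : a ≠ 0 := by rintro rfl; simp at h0
  have hf0 : f ≠ 0 := by rintro rfl; simp at h0
  exact (hf V hV hf0).trans (Scheme.ord_le_smul hV ha f)

/-- The sections of `O_X(S) = O_X(⌊S⌋)` over the nonempty open subset `W`, as a
`Γ(X, W)`-submodule of the function field. -/
def sections [IsNormalScheme X] (S : QDivisor X) (W : X.Opens) [Nonempty W] :
    Submodule Γ(X, W) X.functionField where
  __ := sectionsAdd S W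
  smul_mem' a _ hf := smul_mem_sectionsAdd S W a hf

lemma sectionsAdd_anti [IsNormalScheme X] (S : QDivisor X) {W₁ W₂ : X.Opens} (h : W₁ ≤ W₂) :
    sectionsAdd S W₂ ≤ sectionsAdd S W₁ :=
  fun _ hf V hV => hf V (h hV)

lemma mul_mem_sectionsAdd [IsNormalScheme X] {S S' : QDivisor X} {W : X.Opens}
    {f g : X.functionField} (hf : f ∈ sectionsAdd S W) (hg : g ∈ sectionsAdd S' W) :
    f * g ∈ sectionsAdd (S + S') W := by
  intro V hV h0
  have hf0 := left_ne_zero_of_mul h0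
  have hg0 := right_ne_zero_of_mul h0
  rw [Scheme.ord_mul hf0 hg0]
  have h1 := hf V hV hf0
  have h2 := hg V hV hg0
  have h3 : ⌊S V⌋ + ⌊S' V⌋ ≤ ⌊(S + S') V⌋ := by
    rw [Finsupp.add_apply]; exact Int.le_floor_add _ _
  omega

lemma one_mem_sectionsAdd [IsNormalScheme X] (W : X.Opens) :
    (1 : X.functionField) ∈ sectionsAdd (0 : QDivisor X) W := by
  intro V _ _
  have h3 := Scheme.ord_mul (x := V.1) (one_ne_zero (α := X.functionField)) one_ne_zero
  simp only [mul_one] at h3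
  simp only [Finsupp.coe_zero, Pi.zero_apply, Int.floor_zero, neg_zero]
  omega

end Sheaves

/-- `W_{D,d}`: the sum of the components `V` of `D`, with coefficient
`p_V / q_V` in lowest terms, such that `p_V d ≡ -1 mod q_V` and `char k ∣ q_V`. -/
def divisorW (k : Type u) [Field k] {X : Scheme.{u}} (D : QDivisor X) (d : ℤ) : QDivisor X :=
  open Classical in
  ∑ V ∈ D.support with ((D V).num * d ≡ -1 [ZMOD (D V).den] ∧ ringChar k ∣ (D V).den),
    Finsupp.single V 1

/-- `L_{D,d}`: the sum of the components `V` of `D`, with coefficient `p_V / q_V` in lowest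
terms, such that `p_V d ≢ -1 mod q_V` or `char k ∣ q_V`. -/
def divisorL (k : Type u) [Field k] {X : Scheme.{u}} (D : QDivisor X) (d : ℤ) : QDivisor X :=
  open Classical in
  ∑ V ∈ D.support with (¬ (D V).num * d ≡ -1 [ZMOD (D V).den] ∨ ringChar k ∣ (D V).den),
    Finsupp.single V 1

section Rational

variable {K : Type u} [Field K]

/-- Apply additive maps `h i` to the coefficients of `T ^ i` in a Laurent polynomial. -/
def coeffwise (h : ℤ → K →+ K) : K[T;T⁻¹] →+ K[T;T⁻¹] where
  toFun P := .ofCoeff (Finsupp.onFinset P.coeff.support (fun i => h i (P.coeff i)) (by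
    intro i hi
    rw [Finsupp.mem_support_iff]
    intro h0
    rw [h0, map_zero] at hi
    exact hi rfl))
  map_zero' := by ext i; exact map_zero (h i)
  map_add' P Q := by ext i; exact map_add (h i) (P.coeff i) (Q.coeff i)

lemma coeff_coeffwise (h : ℤ → K →+ K) (P : K[T;T⁻¹]) (i : ℤ) :
    (coeffwise h P).coeff i = h i (P.coeff i) := rfl

lemma coeffwise_single (h : ℤ → K →+ K) (i : ℤ) (a : K) :
    coeffwise h (.single i a) = .single i (h i a) := by
  ext j
  rw [coeff_coeffwise, AddMonoidAlgebra.coeff_single, AddMonoidAlgebra.coeff_single]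
  by_cases hij : i = j
  · subst hij; simp
  · simp [hij]

lemma coeffwise_leibniz (h : ℤ → K →+ K)
    (hh : ∀ i j a b, h (i + j) (a * b) = a * h j b + b * h i a) (P Q : K[T;T⁻¹]) :
    coeffwise h (P * Q) = P • coeffwise h Q + Q • coeffwise h P := by
  simp only [smul_eq_mul]
  induction P using AddMonoidAlgebra.induction_linear with
  | zero => simp
  | add P P' hP hP' => simp only [add_mul, mul_add, map_add, hP, hP']; ring
  | single i a =>
    induction Q using AddMonoidAlgebra.induction_linear with
    | zero => simp
    | add Q Q' hQ hQ' => simp only [add_mul, mul_add, map_add, hQ, hQ']; ring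
    | single j b =>
      rw [coeffwise_single, coeffwise_single, AddMonoidAlgebra.single_mul_single,
        AddMonoidAlgebra.single_mul_single, AddMonoidAlgebra.single_mul_single,
        coeffwise_single, hh, add_comm j i, AddMonoidAlgebra.single_add]

variable (K) in
/-- The derivation `T ∂_T`, which multiplies `T ^ i` by `i`. -/
def eulerDer : Derivation K K[T;T⁻¹] K[T;T⁻¹] :=
  Derivation.mk'
    { toFun := coeffwise (fun i => AddMonoidHom.mulLeft (i : K))
      map_add' := map_add _
      map_smul' := by
        intro c P
        ext i
        simp [coeff_coeffwise, mul_left_comm] }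
    (coeffwise_leibniz _ (by intro i j a b; simp; ring))

/-- The extension of a derivation `σ` of `K` to `K[T, T⁻¹]` with `σ(T) = 0`. -/
def extendDer {k : Type u} [Field k] [Algebra k K] (σ : Derivation k K K) :
    Derivation k K[T;T⁻¹] K[T;T⁻¹] :=
  Derivation.mk'
    { toFun := coeffwise (fun _ => (σ : K →ₗ[k] K).toAddMonoidHom)
      map_add' := map_add _
      map_smul' := by
        intro c P
        ext i
        simp [coeff_coeffwise] }
    (coeffwise_leibniz _ (by intro i j a b; simp))

end Rational

section Cylinder

variable (k : Type u) [Field k] {X : Scheme.{u}} [IsIntegral X] [IsLocallyNoetherian X]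
  [IsNormalScheme X] [X.Over (Spec (.of k))]

lemma section_mem_sectionsAdd (W : X.Opens) [Nonempty W] (a : Γ(X, W)) :
    algebraMap Γ(X, W) X.functionField a ∈ sectionsAdd (0 : QDivisor X) W := by
  rw [Algebra.algebraMap_eq_smul_one]
  exact smul_mem_sectionsAdd 0 W a (one_mem_sectionsAdd W)

lemma constant_mem_sectionsAdd (W : X.Opens) (c : k) :
    algebraMap k X.functionField c ∈ sectionsAdd (0 : QDivisor X) W := by
  have : Nonempty (⊤ : X.Opens) := ⟨⟨genericPoint X, trivial⟩⟩
  exact sectionsAdd_anti 0 le_top (section_mem_sectionsAdd ⊤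
    ((X ↘ Spec (.of k)).appTop.hom ((Scheme.ΓSpecIso (.of k)).inv.hom c)))

/-- The sections over `W` of the graded `O_X`-algebra `𝒜 = ⨁ i, O_X(iD) T ^ i`, the direct image
of the structure sheaf of the cylinder `C = Spec_X 𝒜`. -/
def cyl (D : QDivisor X) (W : X.Opens) : Subalgebra k (X.functionField)[T;T⁻¹] where
  carrier := {P | ∀ i : ℤ, P.coeff i ∈ sectionsAdd (i • D) W}
  add_mem' hP hQ i := add_mem (hP i) (hQ i)
  mul_mem' := by
    classical
    intro P Q hP hQ n
    rw [AddMonoidAlgebra.coeff_mul]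
    refine AddSubgroup.sum_mem _ fun i _ => AddSubgroup.sum_mem _ fun j _ => ?_
    dsimp only
    split_ifs with h
    · rw [← h, add_smul]
      exact mul_mem_sectionsAdd (hP i) (hQ j)
    · exact zero_mem _
  algebraMap_mem' c i := by
    rw [LaurentPolynomial.algebraMap_apply, LaurentPolynomial.C_apply]
    split_ifs with h
    · rw [h, zero_smul]
      exact constant_mem_sectionsAdd k W c
    · exact zero_mem _

lemma cyl_anti (D : QDivisor X) {W₁ W₂ : X.Opens} (h : W₁ ≤ W₂) :
    cyl k D W₂ ≤ cyl k D W₁ :=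
  fun _ hP i => sectionsAdd_anti _ h (hP i)

/-- The structure map `O_X → 𝒜`, onto the part of degree zero. -/
def toCyl (D : QDivisor X) (W : X.Opens) [Nonempty W] : Γ(X, W) →+* cyl k D W :=
  (LaurentPolynomial.C.comp (algebraMap Γ(X, W) X.functionField)).codRestrict (cyl k D W) (by
    intro a i
    rw [RingHom.comp_apply, LaurentPolynomial.C_apply]
    split_ifs with h
    · rw [h, zero_smul]
      exact section_mem_sectionsAdd W a
    · exact zero_mem _)

instance cylAlgebra (D : QDivisor X) {W : X.Opens} (W' : OpensIn W) :
    Algebra Γ(X, W) (cyl k D W'.1) :=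
  ((toCyl k D W'.1).comp (X.presheaf.map (homOfLE W'.2.2).op).hom).toAlgebra

instance cyl_smulCommClass (D : QDivisor X) {W : X.Opens} (W' : OpensIn W) :
    SMulCommClass k Γ(X, W) (cyl k D W'.1) where
  smul_comm a b c := by
    simp only [Algebra.smul_def]
    ring

instance cyl_smulCommClass' (D : QDivisor X) {W : X.Opens} (W' : OpensIn W) :
    SMulCommClass Γ(X, W) (cyl k D W'.1) (cyl k D W'.1) where
  smul_comm a b c := by
    simp only [Algebra.smul_def]
    ring

lemma cylAlgebra_smul (D : QDivisor X) {W : X.Opens} (W' : OpensIn W) (a : Γ(X, W))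
    (P : cyl k D W'.1) :
    (a • P).1 = LaurentPolynomial.C (algebraMap Γ(X, W'.1) X.functionField
      (X.presheaf.map (homOfLE W'.2.2).op a)) * P.1 := rfl

/-- The sections over `W` of `(π_* Θ_C)_d = (Der_k π_* O_C)_d`, where `π_* O_C = 𝒜`: the
`k`-linear derivations of the sheaf of rings `𝒜` restricted to `W`, which are homogeneous of
degree `d`. Such a derivation of sheaves consists of a derivation of `𝒜(W')` for each nonempty
open `W' ⊆ W`, compatible with restriction. -/
def derCyl (D : QDivisor X) (d : ℤ) (W : X.Opens) :
    Submodule Γ(X, W) (∀ W' : OpensIn W, Derivation k (cyl k D W'.1) (cyl k D W'.1)) where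
  carrier := {δ |
    (∀ (W₁ W₂ : OpensIn W) (h : W₁.1 ≤ W₂.1) (P : cyl k D W₂.1),
      δ W₁ (Subalgebra.inclusion (cyl_anti k D h) P) =
        Subalgebra.inclusion (cyl_anti k D h) (δ W₂ P)) ∧
    (∀ (W' : OpensIn W) (i : ℤ) (P : cyl k D W'.1),
      (∀ j, j ≠ i → P.1.coeff j = 0) → ∀ j, j ≠ i + d → (δ W' P).1.coeff j = 0)}
  zero_mem' := by
    refine ⟨fun W₁ W₂ h P => ?_, fun W' i P _ j _ => ?_⟩
    · simp
    · simp
  add_mem' := by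
    rintro δ ε ⟨h1, h2⟩ ⟨h3, h4⟩
    refine ⟨fun W₁ W₂ h P => ?_, fun W' i P hP j hj => ?_⟩
    · simp [h1 W₁ W₂ h, h3 W₁ W₂ h]
    · simp [h2 W' i P hP j hj, h4 W' i P hP j hj]
  smul_mem' := by
    rintro a δ ⟨h1, h2⟩
    refine ⟨fun W₁ W₂ h P => ?_, fun W' i P hP j hj => ?_⟩
    · have : Nonempty W := ⟨⟨_, W₁.2.2 W₁.2.1.some.2⟩⟩
      apply Subtype.ext
      simp only [Pi.smul_apply, Derivation.smul_apply, Subalgebra.coe_inclusion,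
        cylAlgebra_smul, h1 W₁ W₂ h]
      rw [algebraMap_restrict W₁.2.2, algebraMap_restrict W₂.2.2]
    · simp only [Pi.smul_apply, Derivation.smul_apply, cylAlgebra_smul]
      rw [← LaurentPolynomial.single_eq_C, AddMonoidAlgebra.coeff_single_zero_mul,
        h2 W' i P hP j hj, mul_zero]

/-- The restriction maps of `(π_* Θ_C)_d`. -/
def derCylRes (D : QDivisor X) (d : ℤ) {W₁ W₂ : X.Opens} (h : W₁ ≤ W₂) (δ : derCyl k D d W₂) :
    derCyl k D d W₁ :=
  ⟨fun W' => δ.1 (W'.mono h), fun V₁ V₂ => δ.2.1 (V₁.mono h) (V₂.mono h),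
    fun W' => δ.2.2 (W'.mono h)⟩

/-- The sections over `W` of `Der_X(S - log L) = O_X(S - L) : O_X(-L)`, the colon being formed in
the constant sheaf of rational `k`-linear derivations. -/
def derLog (S L : QDivisor X) (W : X.Opens) [Nonempty W] :
    Submodule Γ(X, W) (Derivation k X.functionField X.functionField) where
  carrier := {σ | ∀ W' : OpensIn W, ∀ f ∈ sections (-L) W'.1, σ f ∈ sections (S - L) W'.1}
  zero_mem' W' f _ := zero_mem _
  add_mem' hσ hτ W' f hf := add_mem (hσ W' f hf) (hτ W' f hf)
  smul_mem' a σ hσ W' f hf := by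
    rw [Derivation.smul_apply, Algebra.smul_def, ← algebraMap_restrict W'.2.2,
      ← Algebra.smul_def]
    exact Submodule.smul_mem _ _ (hσ W' f hf)

/-- The restriction maps of `O_X(S)`. -/
def sectionsRes (S : QDivisor X) {W₁ W₂ : X.Opens} [Nonempty W₁] [Nonempty W₂] (h : W₁ ≤ W₂)
    (f : sections S W₂) : sections S W₁ :=
  ⟨f.1, sectionsAdd_anti S h f.2⟩

/-- The restriction maps of `Der_X(S - log L)`. -/
def derLogRes (S L : QDivisor X) {W₁ W₂ : X.Opens} [Nonempty W₁] [Nonempty W₂] (h : W₁ ≤ W₂)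
    (σ : derLog k S L W₂) : derLog k S L W₁ :=
  ⟨σ.1, fun W' => σ.2 (W'.mono h)⟩

/-- The value at `P` of the rational derivation `T ^ d (σ + α T ∂_T)`, where `σ` is a rational
`k`-linear derivation of `X`, extended by `σ(T) = 0`, and `α` is a rational function on `X`. -/
def rationalDer (d : ℤ) (σ : Derivation k X.functionField X.functionField)
    (α : X.functionField) (P : (X.functionField)[T;T⁻¹]) : (X.functionField)[T;T⁻¹] :=
  LaurentPolynomial.T d *
    (extendDer σ P + LaurentPolynomial.C α * eulerDer X.functionField P)

end Cylinder

end

end EulerSeq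

/-! Every condition in the statement can be tested at one prime divisor `V` at a time. A rational
function violates the bound of a given `ℚ`-divisor at only finitely many primes, so the others can
be removed by shrinking the open set (`maps_sectionsAdd_iff`). At `V`, write `c = p/q` for the
coefficient of `D`, `t` for a uniformizer, `τ = σ t / t`, and `F n` for the functions of order at
least `n`. Testing `T ^ d (σ + α T ∂_T)` on the generators `t ^ (-⌊ic⌋) T ^ i` gives `i α - ⌊ic⌋ τ ∈
F (⌊ic⌋ - ⌊(i+d)c⌋)` for all `i`, and `i = 0` gives `σ (F 0) ⊆ F (-⌊dc⌋)`.

The divisors `W` and `L` record when these conditions lose or gain one order. The gap `⌊(i+d)c⌋ -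
⌊ic⌋ - ⌊dc⌋` is 0 or 1. If `pd ≡ -1 mod q`, it is 1 for every `i` not divisible by `q`; otherwise it
is 0 for an inverse `i` of `p` modulo `q`, and it is always 0 for `i = q`. The characteristic
decides which indices are invisible because they vanish in `k`. This gives the kernel
(`preservesCylinder_zero_iff`) and the logarithmic condition on `σ`
(`PreservesCylinder.isLogDerivation`).

Conversely, a logarithmic `σ` lifts at `V` exactly as soon as `α` is correct modulo `O(dD)`:
congruent to `0` if `V` lies in `L`, and to `(p/q) τ` otherwise (`IsLogDerivation.preservesCylinder`
is the implication needed). Since the components are Cartier, the sum of the `(p/q) σ(g)/g` over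
local equations `g` of the components outside `L` is a local solution (`exists_local_lift`). Local
solutions form a torsor under `O(dD)`, which is trivial on affine open subsets
(`exists_global_of_local`).

That every homogeneous derivation of the sheaf `𝒜` is of the form `T ^ d (σ + α T ∂_T)` follows from
the Leibniz rule, because every rational function is a section of each `O(iD)` over some nonempty
open subset (`exists_isRational`). -/

namespace EulerSeq

noncomputable section

/-! ### Floors of multiples of a fraction. -/

section FloorArithmetic

lemma floor_intCast_mul (c : ℚ) (i : ℤ) : ⌊(i : ℚ) * c⌋ = i * c.num / c.den := by
  rw [← Rat.floor_intCast_div_natCast]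
  congr 1
  push_cast
  rw [mul_div_assoc, Rat.num_div_den]

lemma dvd_mul_num_iff (c : ℚ) (i : ℤ) : (c.den : ℤ) ∣ i * c.num ↔ (c.den : ℤ) ∣ i := by
  refine ⟨fun h => ?_, fun h => h.mul_right _⟩
  exact IsCoprime.dvd_of_dvd_mul_right (Rat.isCoprime_num_den c).symm h

lemma floor_add_le (c : ℚ) (i d : ℤ) :
    ⌊(i : ℚ) * c⌋ + ⌊(d : ℚ) * c⌋ ≤ ⌊((i + d : ℤ) : ℚ) * c⌋ := by
  push_cast
  rw [add_mul]
  exact Int.le_floor_add _ _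

lemma modEq_iff_den_dvd (c : ℚ) (d : ℤ) :
    c.num * d ≡ -1 [ZMOD c.den] ↔ (c.den : ℤ) ∣ d * c.num + 1 := by
  rw [Int.modEq_iff_dvd, ← dvd_neg]
  ring_nf

/-- Modulo the denominator `q`, the remainder of `dp` is `q - 1` and that of `ip` is positive, so
adding them produces a carry. -/
lemma floor_add_one_le {c : ℚ} {i d : ℤ} (hd : c.num * d ≡ -1 [ZMOD c.den])
    (hi : ¬ (c.den : ℤ) ∣ i) :
    ⌊(i : ℚ) * c⌋ + ⌊(d : ℚ) * c⌋ + 1 ≤ ⌊((i + d : ℤ) : ℚ) * c⌋ := by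
  have hq : (0 : ℤ) < c.den := by exact_mod_cast c.pos
  obtain ⟨e, he⟩ := (modEq_iff_den_dvd c d).mp hd
  rw [← dvd_mul_num_iff] at hi
  simp only [floor_intCast_mul]
  have hd' : d * c.num / c.den = e - 1 := by
    rw [Int.ediv_eq_iff_of_pos hq]
    constructor <;> nlinarith
  have h1 := Int.mul_ediv_add_emod (i * c.num) c.den
  have h2 := Int.emod_pos_of_not_dvd hi
  have h3 : 0 < i * c.num % c.den := by
    rcases h2 with h2 | h2
    · omega
    · exact h2
  rw [hd', Int.le_ediv_iff_mul_le hq]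
  nlinarith

lemma floor_den_mul (c : ℚ) : ⌊((c.den : ℤ) : ℚ) * c⌋ = c.num := by
  have hq : (0 : ℤ) < c.den := by exact_mod_cast c.pos
  rw [floor_intCast_mul, Int.mul_ediv_cancel_left _ hq.ne']

lemma floor_den_add_mul (c : ℚ) (d : ℤ) :
    ⌊((c.den + d : ℤ) : ℚ) * c⌋ = c.num + ⌊(d : ℚ) * c⌋ := by
  have hq : (0 : ℤ) < c.den := by exact_mod_cast c.pos
  rw [floor_intCast_mul, floor_intCast_mul, add_mul, Int.add_ediv_of_dvd_left (dvd_mul_right _ _),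
    Int.mul_ediv_cancel_left _ hq.ne']

/-- An inverse `i` of the numerator of `c` modulo the denominator. -/
lemma exists_mul_num_eq (c : ℚ) : ∃ i n : ℤ, i * c.num = 1 + c.den * n := by
  obtain ⟨a, b, h⟩ := Rat.isCoprime_num_den c
  exact ⟨a, -b, by linarith⟩

/-- The remainder of `ip` is 1, which is a legitimate remainder only if the denominator is not 1. -/
lemma floor_mul_of_mul_num_eq {c : ℚ} (hc : c.den ≠ 1) {i n : ℤ}
    (h : i * c.num = 1 + c.den * n) : ⌊(i : ℚ) * c⌋ = n := by
  have hq := c.pos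
  rw [floor_intCast_mul, h, Int.ediv_eq_iff_of_pos (by omega)]
  constructor
  · nlinarith
  · have : (1 : ℤ) < c.den := by omega
    nlinarith

/-- Adding the remainder 1 of `ip` to the remainder of `dp` carries only if the latter is `q - 1`.
The next lemma is the case with a carry. -/
lemma floor_add_mul_of_mul_num_eq {c : ℚ} {i n : ℤ} (h : i * c.num = 1 + c.den * n)
    {d : ℤ} (hd : ¬ c.num * d ≡ -1 [ZMOD c.den]) :
    ⌊((i + d : ℤ) : ℚ) * c⌋ = n + ⌊(d : ℚ) * c⌋ := by
  have hq : (0 : ℤ) < c.den := by exact_mod_cast c.pos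
  rw [modEq_iff_den_dvd] at hd
  have h1 := Int.mul_ediv_add_emod (d * c.num) c.den
  have h2 := Int.emod_lt_of_pos (d * c.num) hq
  have h3 := Int.emod_nonneg (d * c.num) hq.ne'
  rw [floor_intCast_mul, floor_intCast_mul, add_mul, h, Int.ediv_eq_iff_of_pos hq]
  have h4 : d * c.num % c.den + 1 ≠ c.den := by
    intro h5
    exact hd ⟨d * c.num / c.den + 1, by linarith⟩
  have h5 : d * c.num % c.den + 1 < c.den := by omega
  constructor <;> nlinarith

lemma floor_add_mul_of_mul_num_eq' {c : ℚ} {i n : ℤ} (h : i * c.num = 1 + c.den * n)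
    {d : ℤ} (hd : c.num * d ≡ -1 [ZMOD c.den]) :
    ⌊((i + d : ℤ) : ℚ) * c⌋ = n + ⌊(d : ℚ) * c⌋ + 1 := by
  have hq : (0 : ℤ) < c.den := by exact_mod_cast c.pos
  obtain ⟨e, he⟩ := (modEq_iff_den_dvd c d).mp hd
  have hd' : d * c.num / c.den = e - 1 := by
    rw [Int.ediv_eq_iff_of_pos hq]
    constructor <;> nlinarith
  rw [floor_intCast_mul, floor_intCast_mul, hd', Int.ediv_eq_iff_of_pos hq, add_mul i, h]
  constructor <;> nlinarith

end FloorArithmetic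

/-! ### Derivations at a single prime divisor. -/

section LocalDerivations

variable {k K : Type u} [Field k] [Field K] [Algebra k K]

/-- The filtration `F` of the field `K` by the powers of the maximal ideal of a discrete valuation
ring containing `k`, with uniformizer `t`. -/
structure IsOrderFiltration (k : Type u) {K : Type u} [Field k] [Field K] [Algebra k K]
    (F : ℤ → AddSubgroup K) (t : K) : Prop where
  anti {m n : ℤ} : m ≤ n → F n ≤ F m
  mul_mem {m n : ℤ} {a b : K} : a ∈ F m → b ∈ F n → a * b ∈ F (m + n)
  algebraMap_mem (c : k) : algebraMap k K c ∈ F 0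
  ne_zero : t ≠ 0
  mem : t ∈ F 1
  inv_mem : t⁻¹ ∈ F (-1)

namespace IsOrderFiltration

variable {F : ℤ → AddSubgroup K} {t : K} (hF : IsOrderFiltration k F t)

include hF

lemma mul_mem' {m n l : ℤ} {a b : K} (ha : a ∈ F m) (hb : b ∈ F n) (h : l ≤ m + n) :
    a * b ∈ F l :=
  hF.anti h (hF.mul_mem ha hb)

lemma one_mem : (1 : K) ∈ F 0 := by
  simpa using hF.algebraMap_mem 1

lemma intCast_mem (n : ℤ) : (n : K) ∈ F 0 := by
  simpa using hF.algebraMap_mem n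

lemma pow_mem {x : K} {m : ℤ} (hx : x ∈ F m) (n : ℕ) : x ^ n ∈ F (n * m) := by
  induction n with
  | zero => simpa using hF.one_mem
  | succ n ih => rw [pow_succ]; exact hF.mul_mem' ih hx (by push_cast; linarith)

lemma zpow_mem (n : ℤ) : t ^ n ∈ F n := by
  cases n with
  | ofNat n => simpa using hF.pow_mem hF.mem n
  | negSucc n =>
    have := hF.pow_mem hF.inv_mem (n + 1)
    rw [zpow_negSucc, ← inv_pow]
    convert this using 1
    congr 1
    rw [Int.negSucc_eq]
    push_cast
    ring

lemma zpow_mul_mem_iff {n m : ℤ} {x : K} : t ^ n * x ∈ F m ↔ x ∈ F (m - n) := by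
  refine ⟨fun h => ?_, fun h => hF.mul_mem' (hF.zpow_mem n) h (by linarith)⟩
  have := hF.mul_mem' (l := m - n) (hF.zpow_mem (-n)) h (by linarith)
  rwa [← mul_assoc, ← zpow_add₀ hF.ne_zero, neg_add_cancel, zpow_zero, one_mul] at this

lemma mem_iff_exists {n : ℤ} {x : K} : x ∈ F n ↔ ∃ u ∈ F 0, x = t ^ n * u := by
  constructor
  · intro h
    refine ⟨t ^ (-n) * x, hF.mul_mem' (hF.zpow_mem _) h (by linarith), ?_⟩
    rw [← mul_assoc, ← zpow_add₀ hF.ne_zero, add_neg_cancel, zpow_zero, one_mul]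
  · rintro ⟨u, hu, rfl⟩
    exact hF.mul_mem' (hF.zpow_mem n) hu (by linarith)

lemma div_mem {n : ℤ} {x : K} (h : x ∈ F (n + 1)) : x / t ∈ F n := by
  rw [div_eq_mul_inv]
  exact hF.mul_mem' h hF.inv_mem (by linarith)

lemma inv_intCast_mem (n : ℤ) : (n : K)⁻¹ ∈ F 0 := by
  simpa using hF.algebraMap_mem (n : k)⁻¹

/-- The filtration contains the constants in degree 0, so an integer that is nonzero in `k` is a
unit there. -/
lemma mem_of_intCast_mul_mem {n m : ℤ} (hn : (n : k) ≠ 0) {x : K} (h : (n : K) * x ∈ F m) :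
    x ∈ F m := by
  have hn' : (n : K) ≠ 0 := by
    rw [← map_intCast (algebraMap k K)]
    exact (map_ne_zero _).mpr hn
  have := hF.mul_mem' (l := m) (hF.inv_intCast_mem n) h (by linarith)
  rwa [inv_mul_cancel_left₀ hn'] at this

end IsOrderFiltration

/-- `T ^ d (σ + α T ∂_T)` preserves `⨁ i, F (-⌊i c⌋) T ^ i`. -/
def PreservesCylinder (F : ℤ → AddSubgroup K) (c : ℚ) (d : ℤ) (σ : Derivation k K K) (α : K) :
    Prop :=
  ∀ (i : ℤ), ∀ f ∈ F (-⌊(i : ℚ) * c⌋), σ f + i * α * f ∈ F (-⌊((i + d : ℤ) : ℚ) * c⌋)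

/-- The derivations mapping `F l` to `F (m + l)`. -/
def IsLogDerivation (F : ℤ → AddSubgroup K) (m l : ℤ) (σ : Derivation k K K) : Prop :=
  ∀ f ∈ F l, σ f ∈ F (m + l)

variable (k) in
/-- The coefficient of the divisor `W_{D,d}` at a prime divisor at which `D` has
coefficient `c`. -/
def coeffW (c : ℚ) (d : ℤ) : ℤ :=
  open Classical in if c.num * d ≡ -1 [ZMOD c.den] ∧ ringChar k ∣ c.den then 1 else 0

variable (k) in
/-- The coefficient of the divisor `L_{D,d}` at a prime divisor at which `D` has
coefficient `c`. -/
def coeffL (c : ℚ) (d : ℤ) : ℤ :=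
  open Classical in if ¬ c.num * d ≡ -1 [ZMOD c.den] ∨ ringChar k ∣ c.den then 1 else 0

lemma coeffL_eq_zero_iff {c : ℚ} {d : ℤ} :
    coeffL k c d = 0 ↔ c.num * d ≡ -1 [ZMOD c.den] ∧ ¬ ringChar k ∣ c.den := by
  rw [coeffL]
  split_ifs with h
  · simp; tauto
  · simp; tauto

lemma coeffL_eq_one_iff {c : ℚ} {d : ℤ} :
    coeffL k c d = 1 ↔ ¬ c.num * d ≡ -1 [ZMOD c.den] ∨ ringChar k ∣ c.den := by
  rw [coeffL]
  split_ifs with h <;> simp [h]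

lemma coeffL_eq_zero_or_one (c : ℚ) (d : ℤ) : coeffL k c d = 0 ∨ coeffL k c d = 1 := by
  rw [coeffL]
  split_ifs <;> simp

/-- This treats all characteristics alike: in characteristic zero both sides are false, because 0
divides no positive denominator. -/
lemma den_cast_eq_zero_iff {c : ℚ} : ((c.den : ℤ) : k) = 0 ↔ ringChar k ∣ c.den := by
  rw [Int.cast_natCast, ringChar.spec]

lemma den_ne_one_of_ringChar_dvd {c : ℚ} (h : ringChar k ∣ c.den) : c.den ≠ 1 := by
  rw [← den_cast_eq_zero_iff] at h
  intro h1
  simp [h1] at h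

lemma num_cast_ne_zero_of_ringChar_dvd {c : ℚ} (h : ringChar k ∣ c.den) :
    (c.num : k) ≠ 0 := by
  intro h0
  obtain ⟨i, n, hin⟩ := exists_mul_num_eq c
  have := congrArg (Int.cast : ℤ → k) hin
  push_cast at this
  rw [← den_cast_eq_zero_iff, Int.cast_natCast] at h
  simp [h0, h] at this

lemma not_den_dvd_of_cast_ne_zero {c : ℚ} (h : ringChar k ∣ c.den) {i : ℤ}
    (hi : (i : k) ≠ 0) : ¬ (c.den : ℤ) ∣ i := by
  rintro ⟨e, rfl⟩
  rw [← den_cast_eq_zero_iff] at h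
  rw [Int.cast_mul, h, zero_mul] at hi
  exact hi rfl

section

variable {F : ℤ → AddSubgroup K} {t : K} (hF : IsOrderFiltration k F t) {c : ℚ} {d : ℤ}
  {σ : Derivation k K K} {α : K}

include hF

lemma preservesCylinder_zero_iff :
    PreservesCylinder F c d (0 : Derivation k K K) α ↔
      α ∈ F (-⌊(d : ℚ) * c⌋ - coeffW k c d) := by
  simp only [PreservesCylinder, Derivation.zero_apply, zero_add]
  constructor
  · intro h
    -- The condition is tested on the generator `t ^ (-⌊ic⌋)` of `F (-⌊ic⌋)`.
    have key (i : ℤ) (hi : (i : k) ≠ 0) :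
        α ∈ F (⌊(i : ℚ) * c⌋ - ⌊((i + d : ℤ) : ℚ) * c⌋) := by
      have := h i _ (hF.zpow_mem _)
      rw [mul_comm _ (t ^ _), hF.zpow_mul_mem_iff] at this
      exact hF.anti (by linarith) (hF.mem_of_intCast_mul_mem hi this)
    -- If the denominator vanishes in `k`, the test index is an inverse of the numerator modulo the
    -- denominator, which is nonzero in `k`; otherwise the denominator itself serves.
    by_cases hq : ringChar k ∣ c.den
    · obtain ⟨i, n, hin⟩ := exists_mul_num_eq c
      have hi : (i : k) ≠ 0 := by
        intro h0
        have := congrArg (Int.cast : ℤ → k) hin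
        push_cast at this
        rw [← den_cast_eq_zero_iff, Int.cast_natCast] at hq
        simp [h0, hq] at this
      have h1 := key i hi
      rw [floor_mul_of_mul_num_eq (den_ne_one_of_ringChar_dvd hq) hin] at h1
      by_cases hd : c.num * d ≡ -1 [ZMOD c.den]
      · rw [floor_add_mul_of_mul_num_eq' hin hd] at h1
        rw [coeffW, if_pos ⟨hd, hq⟩]
        exact hF.anti (by linarith) h1
      · rw [floor_add_mul_of_mul_num_eq hin hd] at h1
        rw [coeffW, if_neg (by tauto)]
        exact hF.anti (by linarith) h1
    · rw [coeffW, if_neg (by tauto)]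
      have h1 := key c.den (by rwa [Ne, den_cast_eq_zero_iff])
      rw [floor_den_mul, floor_den_add_mul] at h1
      exact hF.anti (by linarith) h1
  · intro h i f hf
    by_cases hi : (i : k) = 0
    · have : (i : K) = 0 := by rw [← map_intCast (algebraMap k K), hi, map_zero]
      rw [this, zero_mul, zero_mul]
      exact zero_mem _
    have h1 := hF.mul_mem (hF.mul_mem (hF.intCast_mem i) h) hf
    refine hF.anti ?_ h1
    rw [coeffW]
    -- Where `W` has coefficient 1, multiples of the denominator vanish in `k`; every remaining
    -- index gains the missing order by a carry.
    split_ifs with hw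
    · have := floor_add_one_le hw.1 (not_den_dvd_of_cast_ne_zero hw.2 hi)
      linarith
    · have := floor_add_le c i d
      linarith

lemma PreservesCylinder.isLogDerivation (h : PreservesCylinder F c d σ α) :
    IsLogDerivation F (-⌊(d : ℚ) * c⌋) (coeffL k c d) σ := by
  have h0 : ∀ f ∈ F 0, σ f ∈ F (-⌊(d : ℚ) * c⌋) := by
    intro f hf
    simpa using h 0 f (by simpa using hf)
  rcases coeffL_eq_zero_or_one (k := k) c d with hl | hl
  · rw [hl]
    simpa [IsLogDerivation] using h0
  · have key (i : ℤ) : i * α - ⌊(i : ℚ) * c⌋ * (σ t / t) ∈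
        F (⌊(i : ℚ) * c⌋ - ⌊((i + d : ℤ) : ℚ) * c⌋) := by
      have h1 := h i _ (hF.zpow_mem _)
      have h2 : σ (t ^ (-⌊(i : ℚ) * c⌋)) + i * α * t ^ (-⌊(i : ℚ) * c⌋) =
          t ^ (-⌊(i : ℚ) * c⌋) * (i * α - ⌊(i : ℚ) * c⌋ * (σ t / t)) := by
        rw [Derivation.leibniz_zpow, zpow_sub_one₀ hF.ne_zero]
        simp only [zsmul_eq_mul, smul_eq_mul, div_eq_mul_inv]
        push_cast
        ring
      rw [h2, hF.zpow_mul_mem_iff] at h1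
      exact hF.anti (by linarith) h1
    have hτ : σ t / t ∈ F (-⌊(d : ℚ) * c⌋) := by
      by_cases hq : ringChar k ∣ c.den
      -- With the denominator as index the `α` term dies in `k`, leaving the numerator, which is
      -- invertible there, times `σ t / t`.
      · have h1 := key c.den
        rw [floor_den_mul, floor_den_add_mul, ← map_intCast (algebraMap k K),
          den_cast_eq_zero_iff.mpr hq, map_zero, zero_mul, zero_sub, neg_mem_iff] at h1
        exact hF.anti (by linarith)
          (hF.mem_of_intCast_mul_mem (num_cast_ne_zero_of_ringChar_dvd hq) h1)
      · have hd := (coeffL_eq_one_iff.mp hl).resolve_right hq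
        have hden : c.den ≠ 1 := by
          intro h1
          rw [h1] at hd
          exact hd (by simp [Int.modEq_one])
        obtain ⟨i, n, hin⟩ := exists_mul_num_eq c
        have h1 := key i
        rw [floor_mul_of_mul_num_eq hden hin, floor_add_mul_of_mul_num_eq hin hd] at h1
        have h2 := key c.den
        rw [floor_den_mul, floor_den_add_mul] at h2
        -- Eliminate `α` between the indices `i` and `q`: `q (iα - nτ) - i (qα - pτ) = (ip - qn) τ =
        -- τ`.
        have h3 := sub_mem (hF.mul_mem' (l := -⌊(d : ℚ) * c⌋) (hF.intCast_mem c.den) h1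
          (by linarith)) (hF.mul_mem' (hF.intCast_mem i) h2 (by linarith))
        convert h3 using 1
        have h4 := congrArg (Int.cast : ℤ → K) hin
        push_cast at h4 ⊢
        linear_combination (-(σ t / t)) * h4
    intro f hf
    rw [hl] at hf ⊢
    obtain ⟨u, hu, rfl⟩ := hF.mem_iff_exists.mp hf
    rw [zpow_one, Derivation.leibniz, smul_eq_mul, smul_eq_mul]
    refine add_mem (hF.mul_mem' hF.mem (h0 u hu) (by linarith)) ?_
    have := hF.mul_mem' (l := -⌊(d : ℚ) * c⌋ + 1) (hF.mul_mem hu hτ) hF.mem (by linarith)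
    rwa [mul_assoc, div_mul_cancel₀ _ hF.ne_zero] at this

/-- For `l = 1`, `t σ(u) = σ(t u) - u σ(t)` lies in `F (m + 1)`, and one factor `t` can be
cancelled. -/
lemma IsLogDerivation.apply_mem {m l : ℤ} (hl : l = 0 ∨ l = 1) (h : IsLogDerivation F m l σ)
    {u : K} (hu : u ∈ F 0) : σ u ∈ F m := by
  rcases hl with rfl | rfl
  · simpa using h u hu
  · have h1 := h (t * u) (hF.mul_mem' hF.mem hu (by linarith))
    rw [Derivation.leibniz, smul_eq_mul, smul_eq_mul] at h1
    have h2 := (add_mem_cancel_right (hF.mul_mem' hu (h t hF.mem) (by linarith))).mp h1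
    rw [← zpow_one t, hF.zpow_mul_mem_iff] at h2
    simpa using h2

lemma IsLogDerivation.preservesCylinder
    (h : IsLogDerivation F (-⌊(d : ℚ) * c⌋) (coeffL k c d) σ)
    (h1 : coeffL k c d = 1 → α ∈ F (-⌊(d : ℚ) * c⌋))
    (h0 : coeffL k c d = 0 → α - c.num / c.den * (σ t / t) ∈ F (-⌊(d : ℚ) * c⌋)) :
    PreservesCylinder F c d σ α := by
  intro i f hf
  obtain ⟨u, hu, rfl⟩ := hF.mem_iff_exists.mp hf
  have e : σ (t ^ (-⌊(i : ℚ) * c⌋) * u) + i * α * (t ^ (-⌊(i : ℚ) * c⌋) * u) =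
      t ^ (-⌊(i : ℚ) * c⌋) * (σ u + u * (i * α - ⌊(i : ℚ) * c⌋ * (σ t / t))) := by
    rw [Derivation.leibniz, Derivation.leibniz_zpow, zpow_sub_one₀ hF.ne_zero]
    simp only [zsmul_eq_mul, smul_eq_mul, div_eq_mul_inv]
    push_cast
    ring
  have hle := floor_add_le c i d
  rw [e, hF.zpow_mul_mem_iff]
  refine add_mem (hF.anti (by linarith) (h.apply_mem hF (coeffL_eq_zero_or_one c d) hu))
    (hF.mul_mem' hu (n := -⌊((i + d : ℤ) : ℚ) * c⌋ - -⌊(i : ℚ) * c⌋) ?_ (by linarith))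
  rcases coeffL_eq_zero_or_one (k := k) c d with hl | hl
  · obtain ⟨hd, hq⟩ := coeffL_eq_zero_iff.mp hl
    have hq0 : ((c.den : ℤ) : K) ≠ 0 := by
      rw [← map_intCast (algebraMap k K)]
      exact (map_ne_zero _).mpr (den_cast_eq_zero_iff.not.mpr hq)
    -- Split off `i` times the deviation of `α` from `(p/q) τ`. What remains is the remainder of
    -- `ip` modulo `q`, divided by `q`, times `τ`.
    have e2 : i * α - ⌊(i : ℚ) * c⌋ * (σ t / t) = i * (α - c.num / c.den * (σ t / t)) +
        (((c.den : ℤ) : K)⁻¹ * ((i * c.num - c.den * ⌊(i : ℚ) * c⌋ : ℤ) : K)) * (σ t / t) := by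
      push_cast at hq0 ⊢
      field_simp
      ring
    rw [e2]
    refine add_mem (hF.mul_mem' (hF.intCast_mem i) (h0 hl) (by linarith)) ?_
    -- Here `τ` may have one pole too many. Either its coefficient vanishes, or a carry in the
    -- floors makes room for that pole.
    by_cases hi : (c.den : ℤ) ∣ i
    · have : i * c.num - c.den * ⌊(i : ℚ) * c⌋ = 0 := by
        rw [floor_intCast_mul, Int.mul_ediv_cancel' (hi.mul_right _), sub_self]
      rw [this, Int.cast_zero, mul_zero, zero_mul]
      exact zero_mem _
    · have := floor_add_one_le hd hi
      rw [hl] at h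
      have hτ : σ t / t ∈ F (-⌊(d : ℚ) * c⌋ - 1) := by
        refine hF.div_mem (hF.anti (by linarith) (h t (hF.anti (by norm_num) hF.mem)))
      exact hF.mul_mem' (hF.mul_mem (hF.inv_intCast_mem _) (hF.intCast_mem _)) hτ (by linarith)
  · rw [hl] at h
    have hτ : σ t / t ∈ F (-⌊(d : ℚ) * c⌋) := hF.div_mem (h t hF.mem)
    exact sub_mem (hF.mul_mem' (hF.intCast_mem i) (h1 hl) (by linarith))
      (hF.mul_mem' (hF.intCast_mem _) hτ (by linarith))

end

end LocalDerivations

/-! ### The filtration by order of vanishing. -/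

section OrderOfVanishing

variable {X : Scheme.{u}} [IsIntegral X] [IsLocallyNoetherian X]

lemma ord_one (x : X) : Scheme.ord (1 : X.functionField) x = 0 := by
  have := Scheme.ord_mul (x := x) (one_ne_zero (α := X.functionField)) one_ne_zero
  rw [mul_one] at this
  omega

lemma ord_inv {f : X.functionField} (hf : f ≠ 0) (x : X) :
    Scheme.ord f⁻¹ x = -Scheme.ord f x := by
  have := Scheme.ord_mul (x := x) hf (inv_ne_zero hf)
  rw [mul_inv_cancel₀ hf, ord_one] at this
  omega

variable [IsNormalScheme X]

/-- The rational functions of order at least `n` at the prime divisor `V`. -/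
def ordGE (V : PrimeDivisor X) (n : ℤ) : AddSubgroup X.functionField where
  carrier := {f | f ≠ 0 → n ≤ Scheme.ord f V.1}
  zero_mem' h := (h rfl).elim
  add_mem' := by
    intro f g hf hg hfg
    have := isDiscreteValuationRing_stalk V.2
    by_cases hf0 : f = 0
    · subst hf0
      simp only [zero_add] at hfg ⊢
      exact hg hfg
    by_cases hg0 : g = 0
    · subst hg0
      simp only [add_zero] at hfg ⊢
      exact hf hfg
    exact (le_min (hf hf0) (hg hg0)).trans (Scheme.ord_add hfg)
  neg_mem' := by
    intro f hf hf0
    have h1 : (-1 : X.functionField) ≠ 0 := neg_ne_zero.mpr one_ne_zero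
    have h : Scheme.ord (-1 : X.functionField) V.1 = 0 := by
      have h2 := Scheme.ord_mul (x := V.1) h1 h1
      have h3 := Scheme.ord_mul (x := V.1) (one_ne_zero (α := X.functionField)) one_ne_zero
      simp only [mul_neg, mul_one, neg_neg] at h2 h3
      omega
    have hf1 : f ≠ 0 := neg_ne_zero.mp hf0
    rw [← neg_one_mul f, Scheme.ord_mul h1 hf1, h, zero_add]
    exact hf hf1

lemma mem_ordGE {V : PrimeDivisor X} {n : ℤ} {f : X.functionField} :
    f ∈ ordGE V n ↔ (f ≠ 0 → n ≤ Scheme.ord f V.1) := Iff.rfl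

lemma mem_ordGE_ord (V : PrimeDivisor X) (f : X.functionField) :
    f ∈ ordGE V (Scheme.ord f V.1) := fun _ => le_rfl

lemma mem_sectionsAdd {S : QDivisor X} {W : X.Opens} {f : X.functionField} :
    f ∈ sectionsAdd S W ↔ ∀ V : PrimeDivisor X, V.1 ∈ W → f ∈ ordGE V (-⌊S V⌋) := Iff.rfl

lemma germ_mem_ordGE_zero {W : X.Opens} [Nonempty W] (a : Γ(X, W)) {V : PrimeDivisor X}
    (hV : V.1 ∈ W) : algebraMap Γ(X, W) X.functionField a ∈ ordGE V 0 := by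
  simpa using mem_sectionsAdd.mp (section_mem_sectionsAdd W a) V hV

/-- In the discrete valuation ring at `V`, an element of order 0 is a unit, so a regular non-unit
has positive order. -/
lemma germ_mem_ordGE_one {W : X.Opens} [Nonempty W] {a : Γ(X, W)} {V : PrimeDivisor X}
    (hV : V.1 ∈ W) (ha : V.1 ∉ X.basicOpen a) :
    algebraMap Γ(X, W) X.functionField a ∈ ordGE V 1 := by
  intro h0
  have h1 := germ_mem_ordGE_zero a hV h0
  have := isDiscreteValuationRing_stalk V.2
  have hk : Ring.KrullDimLE 1 (X.presheaf.stalk V.1) := krullDimLE_of_coheight_le V.2.le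
  have h2 : Scheme.ord (algebraMap Γ(X, W) X.functionField a) V.1 ≠ 0 := by
    intro h
    rw [Scheme.ord_eq_iff V.2 h0] at h
    rw [Scheme.mem_basicOpen X a V.1 hV] at ha
    refine ha ((Ring.isUnit_iff_ordFrac_one_of_isDiscreteValuationRing
      (K := X.functionField)).mpr ?_)
    rw [Scheme.algebraMap_germ_eq_germToFunctionField]
    exact h
  omega

lemma exists_ord_eq_one (V : PrimeDivisor X) :
    ∃ t : X.functionField, t ≠ 0 ∧ Scheme.ord t V.1 = 1 := by
  have := isDiscreteValuationRing_stalk V.2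
  have hk : Ring.KrullDimLE 1 (X.presheaf.stalk V.1) := krullDimLE_of_coheight_le V.2.le
  obtain ⟨ϖ, hϖ⟩ := IsDiscreteValuationRing.exists_irreducible (X.presheaf.stalk V.1)
  have h0 : algebraMap (X.presheaf.stalk V.1) X.functionField ϖ ≠ 0 := by
    simpa using hϖ.ne_zero
  refine ⟨_, h0, (Scheme.ord_eq_iff V.2 h0).mpr ?_⟩
  exact Ring.ordFrac_irreducible hϖ

lemma ordGE_anti (V : PrimeDivisor X) {m n : ℤ} (h : m ≤ n) : ordGE V n ≤ ordGE V m :=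
  fun _ hf h0 => h.trans (hf h0)

lemma mul_mem_ordGE {V : PrimeDivisor X} {m n l : ℤ} {a b : X.functionField}
    (ha : a ∈ ordGE V m) (hb : b ∈ ordGE V n) (h : l ≤ m + n) : a * b ∈ ordGE V l := by
  intro h0
  have ha0 := left_ne_zero_of_mul h0
  have hb0 := right_ne_zero_of_mul h0
  rw [Scheme.ord_mul ha0 hb0]
  exact h.trans (add_le_add (ha ha0) (hb hb0))

lemma pow_mem_ordGE {V : PrimeDivisor X} {a : X.functionField} (ha : a ∈ ordGE V 1) (n : ℕ) :
    a ^ n ∈ ordGE V n := by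
  induction n with
  | zero => intro _; simp [ord_one]
  | succ n ih => rw [pow_succ]; exact mul_mem_ordGE ih ha (by push_cast; rfl)

lemma isOrderFiltration_ordGE (k : Type u) [Field k] [X.Over (Spec (.of k))]
    (V : PrimeDivisor X) {t : X.functionField} (ht : t ≠ 0) (ht1 : Scheme.ord t V.1 = 1) :
    IsOrderFiltration k (ordGE V) t where
  anti := ordGE_anti V
  mul_mem ha hb := mul_mem_ordGE ha hb le_rfl
  algebraMap_mem c := by
    simpa using mem_sectionsAdd.mp (constant_mem_sectionsAdd k ⊤ c) V trivial
  ne_zero := ht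
  mem _ := ht1.ge
  inv_mem _ := by rw [ord_inv ht, ht1]

end OrderOfVanishing

/-! ### Finiteness of bad primes and reduction to codimension one. -/

section Finiteness

variable {X : Scheme.{u}} [IsIntegral X]

/-- Otherwise `x < y < genericPoint X` would be a chain giving `x` coheight at least 2. -/
lemma eq_of_specializes_of_coheight_eq_one {x y : X} (hx : coheight x = 1)
    (hy : y ≠ genericPoint X) (h : y ⤳ x) : y = x := by
  by_contra hne
  have h1 : x < y := lt_of_le_not_ge (Scheme.le_iff_specializes.mpr h)
    fun h' => hne (h.antisymm (Scheme.le_iff_specializes.mp h')).eq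
  have hg : genericPoint X ⤳ y := genericPoint_specializes y
  have h2 : y < genericPoint X := lt_of_le_not_ge (Scheme.le_iff_specializes.mpr hg)
    fun h' => hy ((Scheme.le_iff_specializes.mp h').antisymm hg).eq
  have h3 := (coheight_add_one_le h1).trans hx.le
  have h4 := (add_le_add_left (coheight_add_one_le h2) 1).trans h3
  have h5 : (2 : ℕ∞) ≤ 1 := le_trans (by rw [add_assoc, one_add_one_eq_two]; exact le_add_self) h4
  exact absurd h5 (by decide)

lemma PrimeDivisor.ne_genericPoint (V : PrimeDivisor X) : V.1 ≠ genericPoint X := by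
  intro h
  have h1 : coheight (genericPoint X) = 0 := by
    rw [coheight_eq_zero]
    intro y _
    exact Scheme.le_iff_specializes.mpr (genericPoint_specializes y)
  rw [← h, V.2] at h1
  exact one_ne_zero h1

/-- The complement of `W` is a finite union of irreducible closed sets, and a point of codimension
one in such a set must be its generic point. -/
lemma finite_primeDivisor_notMem [CompactSpace X] [IsLocallyNoetherian X] (W : X.Opens)
    [hW : Nonempty W] : {V : PrimeDivisor X | V.1 ∉ W}.Finite := by
  have : IsNoetherian X := {}
  obtain ⟨S, hSf, hSc, hSi, hS⟩ :=
    TopologicalSpace.NoetherianSpace.exists_finite_set_isClosed_irreducible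
      (s := (W : Set X)ᶜ) W.isOpen.isClosed_compl
  have hgen : genericPoint X ∈ W :=
    ((genericPoint_spec X).mem_open_set_iff W.isOpen).mpr (by simpa using hW)
  refine Set.Finite.of_finite_image (f := fun V : PrimeDivisor X => closure {V.1})
    (hSf.subset ?_) ?_
  · rintro _ ⟨V, hV, rfl⟩
    have hV' : V.1 ∈ ⋃₀ S := hS ▸ hV
    obtain ⟨Z, hZ, hVZ⟩ := hV'
    obtain ⟨y, hy⟩ := QuasiSober.sober (hSi Z hZ) (hSc Z hZ)
    have hyV : y = V.1 := by
      refine eq_of_specializes_of_coheight_eq_one V.2 ?_ (hy.specializes hVZ)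
      rintro rfl
      have : genericPoint X ∈ (W : Set X)ᶜ := hS ▸ ⟨Z, hZ, hy.mem⟩
      exact this hgen
    subst hyV
    change closure {V.1} ∈ S
    rwa [hy.def]
  · intro V _ V' _ h
    exact Subtype.ext (inseparable_iff_closure_eq.mpr h).eq

/-- Away from `V` itself, finitely many prime divisors can be removed from a neighbourhood
of `V`. -/
lemma exists_openNhds_avoiding {Z : Set (PrimeDivisor X)} (hZ : Z.Finite) (V : PrimeDivisor X)
    {W : X.Opens} (hV : V.1 ∈ W) :
    ∃ W' : OpensIn W, V.1 ∈ W'.1 ∧ ∀ V' : PrimeDivisor X, V'.1 ∈ W'.1 → V' ≠ V → V' ∉ Z := by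
  have hcl : IsClosed (⋃ V' ∈ Z \ {V}, closure {V'.1}) :=
    (hZ.subset Set.sdiff_subset).isClosed_biUnion fun _ _ => isClosed_closure
  let W' : X.Opens := W ⊓ ⟨_, hcl.isOpen_compl⟩
  have hVW : V.1 ∈ W' := by
    refine ⟨hV, ?_⟩
    intro h
    simp only [Set.mem_iUnion] at h
    obtain ⟨V', ⟨_, h1⟩, h2⟩ := h
    exact h1 (Subtype.ext (eq_of_specializes_of_coheight_eq_one V.2 V'.ne_genericPoint
      (specializes_iff_mem_closure.mpr h2)))
  refine ⟨⟨W', ⟨_, hVW⟩, inf_le_left⟩, hVW, fun V' hV' hne hZ' => ?_⟩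
  refine hV'.2 ?_
  simp only [Set.mem_iUnion]
  exact ⟨V', ⟨hZ', hne⟩, subset_closure rfl⟩

lemma exists_opens_avoiding {Z : Set (PrimeDivisor X)} (hZ : Z.Finite) (W : X.Opens)
    [hW : Nonempty W] :
    ∃ W' : OpensIn W, ∀ V : PrimeDivisor X, V.1 ∈ W'.1 → V ∉ Z := by
  have hcl : IsClosed (⋃ V' ∈ Z, closure {V'.1}) :=
    hZ.isClosed_biUnion fun _ _ => isClosed_closure
  let W' : X.Opens := W ⊓ ⟨_, hcl.isOpen_compl⟩
  have hgen : genericPoint X ∈ W :=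
    ((genericPoint_spec X).mem_open_set_iff W.isOpen).mpr (by simpa using hW)
  have hgW : genericPoint X ∈ W' := by
    refine ⟨hgen, ?_⟩
    intro h
    simp only [Set.mem_iUnion] at h
    obtain ⟨V', _, h2⟩ := h
    exact V'.ne_genericPoint
      ((specializes_iff_mem_closure.mpr h2).antisymm (genericPoint_specializes V'.1)).eq
  refine ⟨⟨W', ⟨_, hgW⟩, inf_le_left⟩, fun V' hV' hZ' => ?_⟩
  refine hV'.2 ?_
  simp only [Set.mem_iUnion]
  exact ⟨V', hZ', subset_closure rfl⟩

variable [CompactSpace X] [IsLocallyNoetherian X]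

lemma finite_ord_ne_zero (f : X.functionField) :
    {V : PrimeDivisor X | Scheme.ord f V.1 ≠ 0}.Finite := by
  by_cases hf : f = 0
  · simp [hf]
  obtain ⟨A, -, f', _, rfl, hf'⟩ := exists_isUnit_germ_eq X f hf
  exact (finite_primeDivisor_notMem A).subset fun V hV hVA =>
    hV (Scheme.ord_of_isUnit hf' hVA)

variable [IsNormalScheme X]

lemma finite_notMem_ordGE (S : QDivisor X) (f : X.functionField) :
    {V : PrimeDivisor X | f ∉ ordGE V (-⌊S V⌋)}.Finite := by
  refine ((finite_ord_ne_zero f).union S.support.finite_toSet).subset fun V hV => ?_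
  by_contra h
  rw [Set.mem_union, not_or] at h
  simp only [Set.mem_ofPred_eq, not_not, Finset.mem_coe, Finsupp.notMem_support_iff] at h
  refine hV fun _ => ?_
  simp [h.1, h.2]

lemma exists_mem_sectionsAdd {S : QDivisor X} {f : X.functionField} {V : PrimeDivisor X}
    {W : X.Opens} (hV : V.1 ∈ W) (hf : f ∈ ordGE V (-⌊S V⌋)) :
    ∃ W' : OpensIn W, V.1 ∈ W'.1 ∧ f ∈ sectionsAdd S W'.1 := by
  obtain ⟨W', h1, h2⟩ := exists_openNhds_avoiding (finite_notMem_ordGE S f) V hV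
  refine ⟨W', h1, fun V' hV' => ?_⟩
  by_cases h : V' = V
  · rwa [h]
  · exact not_not.mp (h2 V' hV' h)

/-- An additive map respects two sheaves of rational functions if and only if it does so at each
prime divisor. -/
lemma maps_sectionsAdd_iff {S S' : QDivisor X} {W : X.Opens}
    (h : X.functionField → X.functionField) :
    (∀ W' : OpensIn W, ∀ f ∈ sectionsAdd S W'.1, h f ∈ sectionsAdd S' W'.1) ↔
      ∀ V : PrimeDivisor X, V.1 ∈ W → ∀ f ∈ ordGE V (-⌊S V⌋), h f ∈ ordGE V (-⌊S' V⌋) := by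
  constructor
  · intro H V hV f hf
    obtain ⟨W', hVW', hfW'⟩ := exists_mem_sectionsAdd hV hf
    exact H W' f hfW' V hVW'
  · intro H W' f hf V hV
    exact H V (W'.2.2 hV) f (hf V hV)

end Finiteness

/-! ### Triviality of torsors under `O_X(S)` on affine open subsets. -/

section Gluing

variable {X : Scheme.{u}} [IsIntegral X] [IsLocallyNoetherian X] [CompactSpace X]

/-- The bounded denominators of finitely many rational functions. -/
lemma exists_nat_forall_floor_le (S : QDivisor X) (s : Finset X.functionField) :
    ∃ N : ℕ, ∀ f ∈ s, ∀ V : PrimeDivisor X, -⌊S V⌋ ≤ N + Scheme.ord f V.1 := by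
  classical
  have h1 (f : X.functionField) :
      ∃ N : ℕ, ∀ V : PrimeDivisor X, -⌊S V⌋ ≤ N + Scheme.ord f V.1 := by
    have hfin : {V : PrimeDivisor X | ¬ -⌊S V⌋ ≤ Scheme.ord f V.1}.Finite := by
      refine ((finite_ord_ne_zero f).union S.support.finite_toSet).subset fun V hV => ?_
      by_contra h
      rw [Set.mem_union, not_or] at h
      simp only [Set.mem_ofPred_eq, not_not, Finset.mem_coe, Finsupp.notMem_support_iff] at h
      exact hV (by simp [h.1, h.2])
    obtain ⟨M, hM⟩ := (hfin.image fun V => -⌊S V⌋ - Scheme.ord f V.1).bddAbove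
    refine ⟨M.toNat, fun V => ?_⟩
    by_cases hV : -⌊S V⌋ ≤ Scheme.ord f V.1
    · omega
    · have := hM ⟨V, hV, rfl⟩
      simp only at this
      omega
  choose N hN using h1
  refine ⟨s.sup N, fun f hf V => (hN f V).trans ?_⟩
  have := Finset.le_sup (f := N) hf
  omega

variable [IsNormalScheme X]

/-- The vanishing of the first cohomology of `O_X(S)` on an affine open subset `W`, for torsors
of rational functions: if the condition `P` defines locally a class of rational functions modulo
`O_X(S)`, then it has a global solution. -/
lemma exists_global_of_local {W : X.Opens} (hW : IsAffineOpen W) [Nonempty W] (S : QDivisor X)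
    (P : PrimeDivisor X → X.functionField → Prop)
    (hloc : ∀ x ∈ W, ∃ W' : X.Opens, x ∈ W' ∧ ∃ α, ∀ V : PrimeDivisor X, V.1 ∈ W' →
      V.1 ∈ W → P V α)
    (hsub : ∀ V : PrimeDivisor X, V.1 ∈ W → ∀ α β, P V α → P V β → α - β ∈ ordGE V (-⌊S V⌋))
    (hadd : ∀ V : PrimeDivisor X, V.1 ∈ W → ∀ α β, P V α → β - α ∈ ordGE V (-⌊S V⌋) → P V β) :
    ∃ α, ∀ V : PrimeDivisor X, V.1 ∈ W → P V α := by
  classical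
  let s : Set Γ(X, W) := {h | ∃ α, ∀ V : PrimeDivisor X, V.1 ∈ X.basicOpen h → P V α}
  have hs : Ideal.span s = ⊤ := by
    rw [← hW.self_le_iSup_basicOpen_iff]
    intro x hx
    obtain ⟨W', hxW', α, hα⟩ := hloc x hx
    obtain ⟨h, hle, hxh⟩ := hW.exists_basicOpen_le ⟨x, hxW'⟩ hx
    rw [TopologicalSpace.Opens.mem_iSup]
    exact ⟨⟨h, α, fun V hV => hα V (hle hV) (X.basicOpen_le h hV)⟩, hxh⟩
  obtain ⟨s', hs's, hs'⟩ := (Ideal.span_eq_top_iff_finite s).mp hs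
  -- `A h` will be a solution on the basic open set of `h ∈ s'`; the value 0 for other `h` is never
  -- used.
  have hex : ∀ h : Γ(X, W), ∃ α, h ∈ s' → ∀ V : PrimeDivisor X, V.1 ∈ X.basicOpen h → P V α := by
    intro h
    by_cases hh : h ∈ s'
    · obtain ⟨α, hα⟩ := hs's hh
      exact ⟨α, fun _ => hα⟩
    · exact ⟨0, fun h' => (hh h').elim⟩
  choose A hA using hex
  -- `N` bounds, uniformly in `V`, the orders by which the differences `A h - A g` fail to lie in
  -- `O_X(S)`.
  obtain ⟨N, hN⟩ := exists_nat_forall_floor_le S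
    ((s' ×ˢ s').image fun hh => A hh.1 - A hh.2)
  have h1 : (1 : Γ(X, W)) ∈ Ideal.span ((fun h => h ^ N) '' (s' : Set Γ(X, W))) := by
    rw [Ideal.span_pow_eq_top _ hs']
    trivial
  obtain ⟨c, hc⟩ := (Submodule.mem_span_image_finset_iff_exists_fun' _).mp h1
  let ι : Γ(X, W) →+* X.functionField := algebraMap Γ(X, W) X.functionField
  have hc' : ∑ h ∈ s', ι (c h) * ι h ^ N = 1 := by
    rw [← map_one ι, ← hc, map_sum]
    simp
  -- The local solutions are averaged with the partition of unity `∑ c_h h ^ N = 1`.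
  refine ⟨∑ h ∈ s', ι (c h) * ι h ^ N * A h, fun V hV => ?_⟩
  have hV' : V.1 ∈ ⨆ f : (s' : Set Γ(X, W)), X.basicOpen f.1 := by
    rwa [hW.iSup_basicOpen_eq_self_iff.mpr hs']
  obtain ⟨⟨g, hg⟩, hVg⟩ := TopologicalSpace.Opens.mem_iSup.mp hV'
  refine hadd V hV (A g) _ (hA g hg V hVg) ?_
  have e : ∑ h ∈ s', ι (c h) * ι h ^ N * A h - A g =
      ∑ h ∈ s', ι (c h) * (ι h ^ N * (A h - A g)) := by
    have hg' : A g = ∑ h ∈ s', ι (c h) * ι h ^ N * A g := by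
      rw [← Finset.sum_mul, hc', one_mul]
    conv_lhs => rw [hg', ← Finset.sum_sub_distrib]
    exact Finset.sum_congr rfl fun _ _ => by ring
  rw [e]
  refine sum_mem fun h hh => mul_mem_ordGE (germ_mem_ordGE_zero (c h) hV)
    (n := -⌊S V⌋) ?_ (by linarith)
  -- If `h` does not vanish at `V`, both `A h` and `A g` are solutions there. If it does, `h ^ N`
  -- has order at least `N` and absorbs the defect of `A h - A g`.
  by_cases hVh : V.1 ∈ X.basicOpen h
  · refine mul_mem_ordGE (m := 0) ?_ (hsub V hV _ _ (hA h hh V hVh) (hA g hg V hVg)) (by linarith)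
    rw [← map_pow]
    exact germ_mem_ordGE_zero _ hV
  · exact mul_mem_ordGE (pow_mem_ordGE (germ_mem_ordGE_one hV hVh) N) (mem_ordGE_ord V _)
      (hN _ (Finset.mem_image.mpr ⟨(h, g), Finset.mem_product.mpr ⟨hh, hg⟩, rfl⟩) V)

end Gluing

/-! ### Lifting logarithmic derivations. -/

section LogDerivations

variable {k : Type u} [Field k] {X : Scheme.{u}} 

lemma coeffL_zero (d : ℤ) : coeffL k 0 d = 0 := by
  rw [coeffL_eq_zero_iff]
  refine ⟨by simp [Int.modEq_one], ?_⟩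
  rw [← den_cast_eq_zero_iff]
  simp

lemma coeffW_zero (d : ℤ) : coeffW k 0 d = 0 := by
  rw [coeffW, if_neg]
  rintro ⟨-, h⟩
  rw [← den_cast_eq_zero_iff] at h
  simp at h

/-- The formula also holds off the support of `D`, since the fraction 0 has denominator 1 and its
coefficient in `L` is 0. -/
lemma divisorL_apply (D : QDivisor X) (d : ℤ) (V : PrimeDivisor X) :
    divisorL k D d V = coeffL k (D V) d := by
  classical
  rw [divisorL, Finsupp.finsetSum_apply]
  simp only [Finsupp.single_apply]
  rw [Finset.sum_ite_eq']
  by_cases hV : D V = 0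
  · rw [if_neg, hV, coeffL_zero, Int.cast_zero]
    simp [hV]
  · simp [coeffL, hV]

lemma divisorW_apply (D : QDivisor X) (d : ℤ) (V : PrimeDivisor X) :
    divisorW k D d V = coeffW k (D V) d := by
  classical
  rw [divisorW, Finsupp.finsetSum_apply]
  simp only [Finsupp.single_apply]
  rw [Finset.sum_ite_eq']
  by_cases hV : D V = 0
  · rw [if_neg, hV, coeffW_zero, Int.cast_zero]
    simp [hV]
  · simp [coeffW, hV]

lemma zsmul_apply_eq (D : QDivisor X) (d : ℤ) (V : PrimeDivisor X) : (d • D) V = d * D V := by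
  rw [Finsupp.smul_apply, zsmul_eq_mul]

variable [IsIntegral X] [IsLocallyNoetherian X] [IsNormalScheme X] [X.Over (Spec (.of k))]

lemma mem_derLog_iff [CompactSpace X] (D : QDivisor X) (d : ℤ) (W : X.Opens) [Nonempty W]
    (σ : Derivation k X.functionField X.functionField) :
    σ ∈ derLog k (d • D) (divisorL k D d) W ↔ ∀ V : PrimeDivisor X, V.1 ∈ W →
      IsLogDerivation (ordGE V) (-⌊(d : ℚ) * D V⌋) (coeffL k (D V) d) σ := by
  refine (maps_sectionsAdd_iff (S := -divisorL k D d) (S' := d • D - divisorL k D d) σ).trans ?_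
  refine forall₂_congr fun V _ => ?_
  have h1 : -⌊(-divisorL k D d) V⌋ = coeffL k (D V) d := by
    rw [Finsupp.neg_apply, divisorL_apply, ← Int.cast_neg, Int.floor_intCast, neg_neg]
  have h2 : -⌊(d • D - divisorL k D d) V⌋ = -⌊(d : ℚ) * D V⌋ + coeffL k (D V) d := by
    rw [Finsupp.sub_apply, divisorL_apply, Int.floor_sub_intCast, zsmul_apply_eq]
    ring
  rw [h1, h2]
  rfl

/-- The conditions on `α` at a prime divisor `V` under which `T ^ d (σ + α T ∂_T)` preserves the
cylinder, for a logarithmic derivation `σ`. -/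
def IsLift (D : QDivisor X) (d : ℤ) (σ : Derivation k X.functionField X.functionField)
    (V : PrimeDivisor X) (α : X.functionField) : Prop :=
  (coeffL k (D V) d = 1 → α ∈ ordGE V (-⌊(d • D) V⌋)) ∧
  (coeffL k (D V) d = 0 → ∀ t : X.functionField, t ≠ 0 → Scheme.ord t V.1 = 1 →
    α - (D V).num / (D V).den * (σ t / t) ∈ ordGE V (-⌊(d • D) V⌋))

lemma IsLift.sub_mem {D : QDivisor X} {d : ℤ}
    {σ : Derivation k X.functionField X.functionField} {V : PrimeDivisor X}
    {α β : X.functionField} (hα : IsLift D d σ V α) (hβ : IsLift D d σ V β) :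
    α - β ∈ ordGE V (-⌊(d • D) V⌋) := by
  rcases coeffL_eq_zero_or_one (k := k) (D V) d with hl | hl
  · obtain ⟨t, ht, ht1⟩ := exists_ord_eq_one V
    simpa using _root_.sub_mem (hα.2 hl t ht ht1) (hβ.2 hl t ht ht1)
  · exact _root_.sub_mem (hα.1 hl) (hβ.1 hl)

lemma IsLift.of_sub_mem {D : QDivisor X} {d : ℤ}
    {σ : Derivation k X.functionField X.functionField} {V : PrimeDivisor X}
    {α β : X.functionField} (hα : IsLift D d σ V α)
    (hβ : β - α ∈ ordGE V (-⌊(d • D) V⌋)) : IsLift D d σ V β := by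
  refine ⟨fun hl => ?_, fun hl t ht ht1 => ?_⟩
  · simpa using add_mem hβ (hα.1 hl)
  · simpa using add_mem hβ (hα.2 hl t ht ht1)

/-- The logarithmic derivative of a unit at `V` has no poles beyond those of `O(dD)`. When the
denominator `b` vanishes in the field, the quotient is 0 and causes no trouble. -/
lemma div_mem_of_ord_eq_zero {D : QDivisor X} {d : ℤ}
    {σ : Derivation k X.functionField X.functionField} {V : PrimeDivisor X}
    (hσ : IsLogDerivation (ordGE V) (-⌊(d : ℚ) * D V⌋) (coeffL k (D V) d) σ)
    {g : X.functionField} (hg : g ≠ 0) (hg0 : Scheme.ord g V.1 = 0) (a : ℤ) (b : ℕ) :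
    (a : X.functionField) / b * (σ g / g) ∈ ordGE V (-⌊(d • D) V⌋) := by
  obtain ⟨t, ht, ht1⟩ := exists_ord_eq_one V
  have hF := isOrderFiltration_ordGE k V ht ht1
  have h1 := hσ.apply_mem hF (coeffL_eq_zero_or_one _ _) (u := g) fun _ => hg0.ge
  have h2 : g⁻¹ ∈ ordGE V 0 := fun _ => by rw [ord_inv hg, hg0, neg_zero]
  rw [zsmul_apply_eq, div_eq_mul_inv, div_eq_mul_inv]
  refine mul_mem_ordGE (mul_mem_ordGE (n := 0) (hF.intCast_mem a) ?_ le_rfl)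
    (mul_mem_ordGE h1 h2 le_rfl) (by linarith)
  simpa using hF.inv_intCast_mem b

lemma exists_local_lift (D : QDivisor X) (d : ℤ) {U W : X.Opens} (hWU : W ≤ U)
    (hD : ∀ V ∈ D.support, IsCartierOn V U)
    {σ : Derivation k X.functionField X.functionField}
    (hσ : ∀ V : PrimeDivisor X, V.1 ∈ W →
      IsLogDerivation (ordGE V) (-⌊(d : ℚ) * D V⌋) (coeffL k (D V) d) σ)
    (x : X) (hx : x ∈ W) : ∃ W' : X.Opens, x ∈ W' ∧ ∃ α, ∀ V : PrimeDivisor X, V.1 ∈ W' →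
      V.1 ∈ W → IsLift D d σ V α := by
  classical
  have hD' : ∀ V : D.support, ∃ W : X.Opens, x ∈ W ∧ ∃ g : X.functionField, g ≠ 0 ∧
      ∀ y : PrimeDivisor X, y.1 ∈ W →
        (y = V.1 → Scheme.ord g y.1 = 1) ∧ (y ≠ V.1 → Scheme.ord g y.1 = 0) :=
    fun V => hD V.1 V.2 x (hWU hx)
  choose N hxN g hg0 hg using hD'
  -- Only the components outside `L` contribute to the local solution.
  let s : Finset D.support := Finset.univ.filter fun V => coeffL k (D V.1) d = 0
  let a (V : D.support) : X.functionField := (D V.1).num / (D V.1).den * (σ (g V) / g V)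
  refine ⟨⨅ V, N V, ?_, ∑ V ∈ s, a V, fun V hVN hVW => ?_⟩
  · rw [← SetLike.mem_coe, TopologicalSpace.Opens.coe_iInf, Set.mem_iInter]
    exact hxN
  have hVN' : ∀ V', V.1 ∈ N V' := by
    rwa [← SetLike.mem_coe, TopologicalSpace.Opens.coe_iInf, Set.mem_iInter] at hVN
  have hne (V' : D.support) (h : V ≠ V'.1) : a V' ∈ ordGE V (-⌊(d • D) V⌋) :=
    div_mem_of_ord_eq_zero (hσ V hVW) (hg0 V') ((hg V' V (hVN' V')).2 h) _ _
  refine ⟨fun hl => sum_mem fun V' hV' => hne V' ?_, fun hl t ht ht1 => ?_⟩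
  · rintro rfl
    rw [Finset.mem_filter] at hV'
    rw [hV'.2] at hl
    exact zero_ne_one hl
  · by_cases hV : V ∈ D.support
    · have hVs : (⟨V, hV⟩ : D.support) ∈ s := by simp [s, hl]
      rw [← Finset.add_sum_erase s a hVs, add_sub_right_comm]
      refine add_mem ?_ (sum_mem fun V' hV' => hne V' ?_)
      · have hgV := hg0 ⟨V, hV⟩
        -- The local equation `g` and the uniformizer `t` both have order 1 at `V`, so their
        -- logarithmic derivatives differ by that of the unit `g / t`.
        have e : a ⟨V, hV⟩ - (D V).num / (D V).den * (σ t / t) =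
            (D V).num / (D V).den * (σ (g ⟨V, hV⟩ / t) / (g ⟨V, hV⟩ / t)) := by
          rw [Derivation.leibniz_div]
          simp only [a, smul_eq_mul]
          field_simp
        rw [e]
        refine div_mem_of_ord_eq_zero (hσ V hVW) (div_ne_zero hgV ht) ?_ _ _
        rw [div_eq_mul_inv, Scheme.ord_mul hgV (inv_ne_zero ht), ord_inv ht, ht1,
          (hg ⟨V, hV⟩ V (hVN' _)).1 rfl]
        norm_num
      · rintro rfl
        simp at hV'
    · rw [Finsupp.notMem_support_iff.mp hV]
      simp only [Rat.num_zero, Int.cast_zero, zero_div, zero_mul, sub_zero]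
      refine sum_mem fun V' _ => hne V' ?_
      rintro rfl
      exact hV V'.2

lemma exists_lift [CompactSpace X] (D : QDivisor X) (d : ℤ) {U W : X.Opens} (hWU : W ≤ U) (hW : IsAffineOpen W)
    [Nonempty W] (hD : ∀ V ∈ D.support, IsCartierOn V U)
    {σ : Derivation k X.functionField X.functionField}
    (hσ : σ ∈ derLog k (d • D) (divisorL k D d) W) :
    ∃ α, ∀ V : PrimeDivisor X, V.1 ∈ W → PreservesCylinder (ordGE V) (D V) d σ α := by
  rw [mem_derLog_iff] at hσ
  obtain ⟨α, hα⟩ := exists_global_of_local hW (d • D) (IsLift D d σ)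
    (exists_local_lift D d hWU hD hσ) (fun V _ _ _ h1 h2 => h1.sub_mem h2)
    (fun V _ _ _ h1 h2 => h1.of_sub_mem h2)
  refine ⟨α, fun V hV => ?_⟩
  obtain ⟨t, ht, ht1⟩ := exists_ord_eq_one V
  have h := hα V hV
  rw [IsLift, zsmul_apply_eq] at h
  exact (hσ V hV).preservesCylinder (isOrderFiltration_ordGE k V ht ht1) h.1
    fun hl => h.2 hl t ht ht1

end LogDerivations

/-! ### The derivations `T ^ d (σ + α T ∂_T)` on Laurent polynomials. -/

section RationalDerivations

variable (k : Type u) [Field k] {X : Scheme.{u}} [IsIntegral X] [X.Over (Spec (.of k))]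

/-- The rational derivation `T ^ d (σ + α T ∂_T)`. -/
def rationalDerivation (d : ℤ) (σ : Derivation k X.functionField X.functionField)
    (α : X.functionField) :
    Derivation k (X.functionField)[T;T⁻¹] (X.functionField)[T;T⁻¹] :=
  (LaurentPolynomial.T d : (X.functionField)[T;T⁻¹]) • (extendDer σ +
    LaurentPolynomial.C α • (eulerDer X.functionField).restrictScalars k)

lemma rationalDerivation_apply (d : ℤ) (σ : Derivation k X.functionField X.functionField)
    (α : X.functionField) (P : (X.functionField)[T;T⁻¹]) :
    rationalDerivation k d σ α P = rationalDer k d σ α P := rfl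

lemma coeff_rationalDer (d : ℤ) (σ : Derivation k X.functionField X.functionField)
    (α : X.functionField) (P : (X.functionField)[T;T⁻¹]) (j : ℤ) :
    (rationalDer k d σ α P).coeff (j + d) = σ (P.coeff j) + j * α * P.coeff j := by
  rw [rationalDer, LaurentPolynomial.T, add_comm j d, AddMonoidAlgebra.coeff_single_mul_add,
    AddMonoidAlgebra.coeff_add, Finsupp.add_apply, ← LaurentPolynomial.single_eq_C,
    AddMonoidAlgebra.coeff_single_zero_mul, one_mul]
  change σ (P.coeff j) + α * ((j : X.functionField) * P.coeff j) = _
  ring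

lemma laurent_single_injective {K : Type u} [Field K] {i : ℤ} {a b : K}
    (h : (.single i a : K[T;T⁻¹]) = .single i b) : a = b := by
  have := congrArg (fun P : K[T;T⁻¹] => P.coeff i) h
  simp only [AddMonoidAlgebra.coeff_single, Finsupp.single_eq_same] at this
  exact this

lemma rationalDer_single (d : ℤ) (σ : Derivation k X.functionField X.functionField)
    (α : X.functionField) (i : ℤ) (f : X.functionField) :
    rationalDer k d σ α (.single i f) = .single (i + d) (σ f + i * α * f) := by
  ext j
  obtain ⟨j, rfl⟩ : ∃ j', j = j' + d := ⟨j - d, by ring⟩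
  rw [coeff_rationalDer, AddMonoidAlgebra.coeff_single, AddMonoidAlgebra.coeff_single]
  by_cases h : i = j
  · subst h; simp
  · simp [h]

end RationalDerivations

/-! ### Derivations of the sheaf `𝒜` are rational. -/

section Cylinder

variable {k : Type u} [Field k] {X : Scheme.{u}} [IsIntegral X] [IsLocallyNoetherian X]
  [IsNormalScheme X] [X.Over (Spec (.of k))] {D : QDivisor X} {d : ℤ} {W : X.Opens}

variable (k) in
lemma single_mem_cyl {W : X.Opens} {i : ℤ} {f : X.functionField}
    (hf : f ∈ sectionsAdd (i • D) W) : (.single i f : (X.functionField)[T;T⁻¹]) ∈ cyl k D W := by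
  intro j
  rw [AddMonoidAlgebra.coeff_single, Finsupp.single_apply]
  split_ifs with h
  · rwa [← h]
  · exact zero_mem _

/-- The homogeneous element `f T ^ i` of `𝒜`. -/
def homogeneous {W : X.Opens} {i : ℤ} {f : X.functionField} (hf : f ∈ sectionsAdd (i • D) W) :
    cyl k D W := ⟨.single i f, single_mem_cyl k hf⟩

lemma cyl_eq_sum {W : X.Opens} (P : cyl k D W) :
    P = ∑ i ∈ P.1.coeff.support, homogeneous (P.2 i) := by
  apply Subtype.ext
  rw [AddSubmonoidClass.coe_finsetSum]
  conv_lhs => rw [← AddMonoidAlgebra.sum_coeff_single P.1]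
  rfl

/-- The section `δ` of `(π_* Θ_C)_d` is the rational derivation `T ^ d (σ + α T ∂_T)`. -/
def IsRational (δ : derCyl k D d W) (σ : Derivation k X.functionField X.functionField)
    (α : X.functionField) : Prop :=
  ∀ (W' : OpensIn W) (P : cyl k D W'.1), (δ.1 W' P).1 = rationalDer k d σ α P.1

lemma IsRational.eq {δ δ' : derCyl k D d W}
    {σ : Derivation k X.functionField X.functionField} {α : X.functionField}
    (h : IsRational δ σ α) (h' : IsRational δ' σ α) : δ = δ' := by
  apply Subtype.ext
  funext W'
  ext P : 1
  exact Subtype.ext ((h W' P).trans (h' W' P).symm)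

lemma preservesCylinder_iff [CompactSpace X]
    (σ : Derivation k X.functionField X.functionField) (α : X.functionField) :
    (∀ W' : OpensIn W, ∀ i : ℤ, ∀ f ∈ sectionsAdd (i • D) W'.1,
        σ f + i * α * f ∈ sectionsAdd ((i + d) • D) W'.1) ↔
      ∀ V : PrimeDivisor X, V.1 ∈ W → PreservesCylinder (ordGE V) (D V) d σ α := by
  have key (i : ℤ) := maps_sectionsAdd_iff (S := i • D) (S' := (i + d) • D) (W := W)
    (fun f => σ f + i * α * f)
  simp only [zsmul_apply_eq] at key
  exact ⟨fun H V hV i => (key i).mp (fun W' => H W' i) V hV,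
    fun H W' i => (key i).mpr (fun V hV => H V hV i) W'⟩

variable [CompactSpace X]

variable (D d) in
/-- The derivation `T ^ d (σ + α T ∂_T)` as a section of `(π_* Θ_C)_d`. -/
def mkDerCyl (σ : Derivation k X.functionField X.functionField) (α : X.functionField)
    (h : ∀ V : PrimeDivisor X, V.1 ∈ W → PreservesCylinder (ordGE V) (D V) d σ α) :
    derCyl k D d W :=
  ⟨fun W' => Derivation.mk'
      { toFun := fun P => ⟨rationalDer k d σ α P.1, by
          intro j
          obtain ⟨j, rfl⟩ : ∃ j', j = j' + d := ⟨j - d, by ring⟩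
          rw [coeff_rationalDer]
          exact (preservesCylinder_iff σ α).mpr h W' j _ (P.2 j)⟩
        map_add' := fun P Q => Subtype.ext ((rationalDerivation k d σ α).map_add P.1 Q.1)
        map_smul' := fun c P => Subtype.ext ((rationalDerivation k d σ α).map_smul c P.1) }
      (fun P Q => Subtype.ext ((rationalDerivation k d σ α).leibniz P.1 Q.1)), by
    refine ⟨fun W₁ W₂ _ P => rfl, fun W' i P hP j hj => ?_⟩
    obtain ⟨j, rfl⟩ : ∃ j', j = j' + d := ⟨j - d, by ring⟩
    change (rationalDer k d σ α P.1).coeff (j + d) = 0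
    rw [coeff_rationalDer, hP j (by rintro rfl; exact hj rfl)]
    simp⟩

lemma mkDerCyl_apply (σ : Derivation k X.functionField X.functionField) (α : X.functionField)
    (h : ∀ V : PrimeDivisor X, V.1 ∈ W → PreservesCylinder (ordGE V) (D V) d σ α)
    (W' : OpensIn W) (P : cyl k D W'.1) :
    ((mkDerCyl D d σ α h).1 W' P).1 = rationalDer k d σ α P.1 := rfl

/-- This lets a derivation of the sheaf `𝒜` be evaluated on arbitrary rational functions, after
shrinking the open set. -/
lemma exists_mem_sectionsAdd_pair [Nonempty W] (S S' : QDivisor X) (f g : X.functionField) :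
    ∃ W' : OpensIn W, f ∈ sectionsAdd S W'.1 ∧ g ∈ sectionsAdd S' W'.1 := by
  obtain ⟨W', hW'⟩ := exists_opens_avoiding
    ((finite_notMem_ordGE S f).union (finite_notMem_ordGE S' g)) W
  simp only [Set.mem_union, Set.mem_ofPred_eq, not_or, not_not] at hW'
  exact ⟨W', fun V hV => (hW' V hV).1, fun V hV => (hW' V hV).2⟩

lemma IsRational.preservesCylinder {δ : derCyl k D d W}
    {σ : Derivation k X.functionField X.functionField} {α : X.functionField}
    (h : IsRational δ σ α) (V : PrimeDivisor X) (hV : V.1 ∈ W) :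
    PreservesCylinder (ordGE V) (D V) d σ α := by
  refine (preservesCylinder_iff σ α).mp (fun W' i f hf => ?_) V hV
  have h1 := (δ.1 W' (homogeneous hf)).2 (i + d)
  rw [h W' (homogeneous hf), homogeneous, rationalDer_single, AddMonoidAlgebra.coeff_single,
    Finsupp.single_eq_same] at h1
  exact h1

/-- Degree 0 determines `σ`, and the value at `T` then determines `α`. -/
lemma IsRational.ext [Nonempty W] {δ : derCyl k D d W}
    {σ σ' : Derivation k X.functionField X.functionField} {α α' : X.functionField}
    (h : IsRational δ σ α) (h' : IsRational δ σ' α') : σ = σ' ∧ α = α' := by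
  have key (i : ℤ) (f : X.functionField) : σ f + i * α * f = σ' f + i * α' * f := by
    obtain ⟨W', hf, -⟩ := exists_mem_sectionsAdd_pair (W := W) (i • D) (i • D) f f
    have h1 := (h W' (homogeneous hf)).symm.trans (h' W' (homogeneous hf))
    rw [homogeneous, rationalDer_single, rationalDer_single] at h1
    exact laurent_single_injective h1
  constructor
  · ext f
    simpa using key 0 f
  · simpa using key 1 1

lemma exists_homogeneous_coeff [Nonempty W] (δ : derCyl k D d W) (i : ℤ) (f : X.functionField) :
    ∃ g : X.functionField, ∀ (W' : OpensIn W) (hf : f ∈ sectionsAdd (i • D) W'.1),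
      (δ.1 W' (homogeneous hf)).1 = .single (i + d) g := by
  obtain ⟨W₀, hf₀, -⟩ := exists_mem_sectionsAdd_pair (W := W) (i • D) (i • D) f f
  refine ⟨(δ.1 W₀ (homogeneous hf₀)).1.coeff (i + d), fun W' hf => ?_⟩
  -- As `X` is irreducible, the two open sets meet. The restriction maps of `𝒜` are inclusions, so
  -- values compared on the intersection are equal.
  have hne : Nonempty (W₀.1 ⊓ W'.1 : X.Opens) := by
    have h1 := nonempty_preirreducible_inter W₀.1.isOpen W'.1.isOpen
      (Set.nonempty_coe_sort.mp W₀.2.1) (Set.nonempty_coe_sort.mp W'.2.1)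
    exact Set.nonempty_coe_sort.mpr h1
  let W'' : OpensIn W := ⟨W₀.1 ⊓ W'.1, hne, inf_le_left.trans W₀.2.2⟩
  have h0 := congrArg Subtype.val (δ.2.1 W'' W₀ inf_le_left (homogeneous hf₀))
  have h1 := congrArg Subtype.val (δ.2.1 W'' W' inf_le_right (homogeneous hf))
  have h2 : (δ.1 W' (homogeneous hf)).1 = (δ.1 W₀ (homogeneous hf₀)).1 := h1.symm.trans h0
  rw [h2]
  ext j
  rw [AddMonoidAlgebra.coeff_single, Finsupp.single_apply]
  split_ifs with hj
  · rw [hj]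
  · refine δ.2.2 W₀ i (homogeneous hf₀) (fun l hl => ?_) j (Ne.symm hj)
    rw [homogeneous, AddMonoidAlgebra.coeff_single, Finsupp.single_apply, if_neg (Ne.symm hl)]

lemma exists_isRational [Nonempty W] (δ : derCyl k D d W) : ∃ σ α, IsRational δ σ α := by
  choose c hc using exists_homogeneous_coeff δ
  have hadd (i : ℤ) (f g : X.functionField) : c i (f + g) = c i f + c i g := by
    obtain ⟨W', hf, hg⟩ := exists_mem_sectionsAdd_pair (W := W) (i • D) (i • D) f g
    apply laurent_single_injective (i := i + d)
    rw [← hc i (f + g) W' (add_mem hf hg), AddMonoidAlgebra.single_add, ← hc i f W' hf,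
      ← hc i g W' hg, ← AddMemClass.coe_add, ← map_add]
    congr 2
    exact Subtype.ext (AddMonoidAlgebra.single_add _ _ _)
  have hmul (i j : ℤ) (f g : X.functionField) : c (i + j) (f * g) = f * c j g + g * c i f := by
    obtain ⟨W', hf, hg⟩ := exists_mem_sectionsAdd_pair (W := W) (i • D) (j • D) f g
    have hfg : f * g ∈ sectionsAdd ((i + j) • D) W'.1 := by
      rw [add_smul]
      exact mul_mem_sectionsAdd hf hg
    apply laurent_single_injective (i := i + j + d)
    have e : (homogeneous hfg : cyl k D W'.1) = homogeneous hf * homogeneous hg :=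
      Subtype.ext (AddMonoidAlgebra.single_mul_single _ _ _ _).symm
    rw [← hc (i + j) (f * g) W' hfg, e, Derivation.leibniz]
    change (homogeneous hf : cyl k D W'.1).1 * (δ.1 W' (homogeneous hg)).1 +
      (homogeneous hg : cyl k D W'.1).1 * (δ.1 W' (homogeneous hf)).1 = _
    rw [hc j g W' hg, hc i f W' hf, homogeneous, homogeneous,
      AddMonoidAlgebra.single_mul_single, AddMonoidAlgebra.single_mul_single,
      AddMonoidAlgebra.single_add]
    congr 2 <;> ring
  -- Linearity over `k` comes from the Leibniz rule together with the vanishing on constants.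
  have hsmul (a : k) (f : X.functionField) : c 0 (a • f) = a • c 0 f := by
    have h1 : c 0 (algebraMap k X.functionField a) = 0 := by
      obtain ⟨W', hf, -⟩ := exists_mem_sectionsAdd_pair (W := W) ((0 : ℤ) • D) ((0 : ℤ) • D)
        (algebraMap k X.functionField a) 0
      apply laurent_single_injective (i := 0 + d)
      rw [← hc 0 _ W' hf]
      have e : (homogeneous hf : cyl k D W'.1) = algebraMap k (cyl k D W'.1) a :=
        Subtype.ext rfl
      rw [e, Derivation.map_algebraMap]
      simp
    have h2 := hmul 0 0 (algebraMap k X.functionField a) f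
    rw [h1, mul_zero, add_zero, add_zero] at h2
    rw [Algebra.smul_def, Algebra.smul_def, h2]
  let σ : Derivation k X.functionField X.functionField :=
    Derivation.mk' { toFun := c 0, map_add' := hadd 0, map_smul' := hsmul } (by
      intro f g
      simpa using hmul 0 0 f g)
  have hσ (f : X.functionField) : σ f = c 0 f := rfl
  -- The Leibniz rule for `T ^ i * T ^ j` makes `i ↦ c i 1` additive, hence multiplication by `α = c
  -- 1 1`.
  let τ : ℤ →+ X.functionField :=
    { toFun := fun i => c i 1
      map_zero' := by rw [← hσ]; exact σ.map_one_eq_zero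
      map_add' := fun i j => by
        have := hmul i j 1 1
        simp only [one_mul] at this
        rw [this, add_comm] }
  have hτ (i : ℤ) : c i 1 = i * c 1 1 := by
    have : τ i = i • τ 1 := by rw [← map_zsmul, smul_eq_mul, mul_one]
    rw [zsmul_eq_mul] at this
    exact this
  refine ⟨σ, c 1 1, fun W' P => ?_⟩
  have hP : rationalDer k d σ (c 1 1) P.1 =
      ∑ i ∈ P.1.coeff.support, rationalDer k d σ (c 1 1) (.single i (P.1.coeff i)) := by
    simp only [← rationalDerivation_apply]
    rw [← map_sum]
    congr 1
    exact (AddMonoidAlgebra.sum_coeff_single P.1).symm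
  rw [hP]
  conv_lhs => rw [cyl_eq_sum P, map_sum, AddSubmonoidClass.coe_finsetSum]
  refine Finset.sum_congr rfl fun i _ => ?_
  rw [hc i _ W' (P.2 i), rationalDer_single, hσ]
  -- Factoring `f T ^ i` as `T ^ i * f` gives `c i f = σ f + i α f`.
  have := hmul i 0 1 (P.1.coeff i)
  rw [add_zero, one_mul, one_mul, hτ] at this
  rw [this]
  congr 2
  ring

end Cylinder

/-! ### The morphisms of the sequence and its exactness. -/

section Morphisms

variable {k : Type u} [Field k] {X : Scheme.{u}} [IsIntegral X] [IsLocallyNoetherian X]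
  [IsNormalScheme X] [X.Over (Spec (.of k))] {D : QDivisor X} {d : ℤ} {W : X.Opens}

lemma IsRational.add {δ δ' : derCyl k D d W}
    {σ σ' : Derivation k X.functionField X.functionField} {α α' : X.functionField}
    (h : IsRational δ σ α) (h' : IsRational δ' σ' α') :
    IsRational (δ + δ') (σ + σ') (α + α') := by
  intro W' P
  change (δ.1 W' P).1 + (δ'.1 W' P).1 = _
  rw [h, h']
  ext j
  obtain ⟨j, rfl⟩ : ∃ j', j = j' + d := ⟨j - d, by ring⟩
  rw [AddMonoidAlgebra.coeff_add, Finsupp.add_apply]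
  simp only [coeff_rationalDer, Derivation.add_apply]
  ring

lemma IsRational.smul [Nonempty W] {δ : derCyl k D d W}
    {σ : Derivation k X.functionField X.functionField} {α : X.functionField}
    (h : IsRational δ σ α) (a : Γ(X, W)) : IsRational (a • δ) (a • σ) (a • α) := by
  intro W' P
  change LaurentPolynomial.C (algebraMap Γ(X, W'.1) X.functionField
      (X.presheaf.map (homOfLE W'.2.2).op a)) * (δ.1 W' P).1 = _
  rw [h, algebraMap_restrict]
  ext j
  obtain ⟨j, rfl⟩ : ∃ j', j = j' + d := ⟨j - d, by ring⟩
  rw [← LaurentPolynomial.single_eq_C, AddMonoidAlgebra.coeff_single_zero_mul]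
  simp only [coeff_rationalDer, Derivation.smul_apply, Algebra.smul_def]
  ring

lemma IsRational.res {W₁ W₂ : X.Opens} {δ : derCyl k D d W₂}
    {σ : Derivation k X.functionField X.functionField} {α : X.functionField}
    (h : IsRational δ σ α) (hW : W₁ ≤ W₂) : IsRational (derCylRes k D d hW δ) σ α :=
  fun W' P => h (W'.mono hW) P

/-- This is the local computation for `σ = 0`, and identifies the kernel of the symbol map. -/
lemma mem_sections_iff [Nonempty W] (α : X.functionField) :
    α ∈ sections (d • D + divisorW k D d) W ↔ ∀ V : PrimeDivisor X, V.1 ∈ W →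
      PreservesCylinder (ordGE V) (D V) d (0 : Derivation k X.functionField X.functionField) α := by
  refine forall₂_congr fun V _ => ?_
  obtain ⟨t, ht, ht1⟩ := exists_ord_eq_one V
  rw [preservesCylinder_zero_iff (isOrderFiltration_ordGE k V ht ht1), Finsupp.add_apply,
    divisorW_apply, Int.floor_add_intCast, zsmul_apply_eq, ← neg_add', mem_ordGE]

variable [CompactSpace X]

variable (D d) in
/-- The morphism `α ↦ α T ^ d T ∂_T`. -/
def eulerHom (W : X.Opens) [Nonempty W] :
    sections (d • D + divisorW k D d) W →ₗ[Γ(X, W)] derCyl k D d W where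
  toFun α := mkDerCyl D d 0 α.1 ((mem_sections_iff α.1).mp α.2)
  map_add' α β := by
    refine IsRational.eq (σ := 0) (α := α.1 + β.1) (mkDerCyl_apply _ _ _) ?_
    simpa using IsRational.add (mkDerCyl_apply (0 : Derivation k X.functionField X.functionField)
      α.1 ((mem_sections_iff α.1).mp α.2)) (mkDerCyl_apply 0 β.1 ((mem_sections_iff β.1).mp β.2))
  map_smul' a α := by
    refine IsRational.eq (σ := 0) (α := a • α.1) (mkDerCyl_apply _ _ _) ?_
    simpa using IsRational.smul (mkDerCyl_apply (0 : Derivation k X.functionField X.functionField)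
      α.1 ((mem_sections_iff α.1).mp α.2)) a

lemma isRational_eulerHom [Nonempty W] (α : sections (d • D + divisorW k D d) W) :
    IsRational (eulerHom D d W α) (0 : Derivation k X.functionField X.functionField) α.1 :=
  mkDerCyl_apply _ _ ((mem_sections_iff α.1).mp α.2)

/-- The derivation `σ` in `δ = T ^ d (σ + α T ∂_T)`. -/
def symbolDer [Nonempty W] (δ : derCyl k D d W) : Derivation k X.functionField X.functionField :=
  (exists_isRational δ).choose

lemma exists_isRational_symbolDer [Nonempty W] (δ : derCyl k D d W) :
    ∃ α, IsRational δ (symbolDer δ) α :=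
  (exists_isRational δ).choose_spec

lemma IsRational.symbolDer_eq [Nonempty W] {δ : derCyl k D d W}
    {σ : Derivation k X.functionField X.functionField} {α : X.functionField}
    (h : IsRational δ σ α) : symbolDer δ = σ :=
  ((exists_isRational_symbolDer δ).choose_spec.ext h).1

lemma symbolDer_mem [Nonempty W] (δ : derCyl k D d W) :
    symbolDer δ ∈ derLog k (d • D) (divisorL k D d) W := by
  obtain ⟨α, hα⟩ := exists_isRational_symbolDer δ
  rw [mem_derLog_iff]
  intro V hV
  obtain ⟨t, ht, ht1⟩ := exists_ord_eq_one V
  exact (hα.preservesCylinder V hV).isLogDerivation (isOrderFiltration_ordGE k V ht ht1)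

variable (D d) in
/-- The morphism `T ^ d (σ + α T ∂_T) ↦ σ`. -/
def symbolHom (W : X.Opens) [Nonempty W] :
    derCyl k D d W →ₗ[Γ(X, W)] derLog k (d • D) (divisorL k D d) W where
  toFun δ := ⟨symbolDer δ, symbolDer_mem δ⟩
  map_add' δ δ' := by
    obtain ⟨α, hα⟩ := exists_isRational_symbolDer δ
    obtain ⟨α', hα'⟩ := exists_isRational_symbolDer δ'
    exact Subtype.ext (hα.add hα').symbolDer_eq
  map_smul' a δ := by
    obtain ⟨α, hα⟩ := exists_isRational_symbolDer δ
    exact Subtype.ext (hα.smul a).symbolDer_eq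

lemma eulerHom_injective [Nonempty W] :
    Function.Injective (eulerHom (k := k) D d W) := by
  intro α β h
  have h1 := isRational_eulerHom α
  rw [h] at h1
  exact Subtype.ext (h1.ext (isRational_eulerHom β)).2

lemma exact_eulerHom_symbolHom [Nonempty W] :
    Function.Exact (eulerHom (k := k) D d W) (symbolHom D d W) := by
  intro δ
  constructor
  · intro h
    obtain ⟨α, hα⟩ := exists_isRational_symbolDer δ
    have h0 : symbolDer δ = 0 := congrArg Subtype.val h
    rw [h0] at hα
    exact ⟨⟨α, (mem_sections_iff (k := k) α).mpr hα.preservesCylinder⟩,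
      IsRational.eq (isRational_eulerHom _) hα⟩
  · rintro ⟨α, rfl⟩
    exact Subtype.ext (isRational_eulerHom α).symbolDer_eq

lemma symbolHom_surjective {U : X.Opens} (hWU : W ≤ U) (hW : IsAffineOpen W) [Nonempty W]
    (hD : ∀ V ∈ D.support, IsCartierOn V U) :
    Function.Surjective (symbolHom (k := k) D d W) := by
  intro σ
  obtain ⟨α, hα⟩ := exists_lift D d hWU hW hD σ.2
  have h : IsRational (mkDerCyl D d σ.1 α hα) σ.1 α := mkDerCyl_apply _ _ _
  exact ⟨mkDerCyl D d σ.1 α hα, Subtype.ext h.symbolDer_eq⟩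

end Morphisms

end

end EulerSeq


theorem proposition47 (k : Type u) [Field k] (X : Scheme.{u}) [X.Over (Spec (.of k))]
    [IsSeparated (X ↘ Spec (.of k))] [LocallyOfFiniteType (X ↘ Spec (.of k))]
    [QuasiCompact (X ↘ Spec (.of k))] [AlgebraicGeometry.IsIntegral X] [IsLocallyNoetherian X]
    [EulerSeq.IsNormalScheme X]
    (D : EulerSeq.QDivisor X) (d : ℤ) (U : X.Opens) (hU : IsAffineOpen U)
    (hD : ∀ V ∈ D.support, EulerSeq.IsCartierOn V U) :
    ∃ (φ : ∀ W : EulerSeq.OpensIn U,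
          EulerSeq.sections (d • D + EulerSeq.divisorW k D d) W.1 →ₗ[Γ(X, W.1)]
            EulerSeq.derCyl k D d W.1)
      (ψ : ∀ W : EulerSeq.OpensIn U,
          EulerSeq.derCyl k D d W.1 →ₗ[Γ(X, W.1)]
            EulerSeq.derLog k (d • D) (EulerSeq.divisorL k D d) W.1),
      -- `φ` and `ψ` are morphisms of sheaves on `U`
      (∀ (W₁ W₂ : EulerSeq.OpensIn U) (h : W₁.1 ≤ W₂.1)
          (α : EulerSeq.sections (d • D + EulerSeq.divisorW k D d) W₂.1),
        φ W₁ (EulerSeq.sectionsRes _ h α) = EulerSeq.derCylRes k D d h (φ W₂ α)) ∧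
      (∀ (W₁ W₂ : EulerSeq.OpensIn U) (h : W₁.1 ≤ W₂.1) (δ : EulerSeq.derCyl k D d W₂.1),
        ψ W₁ (EulerSeq.derCylRes k D d h δ) = EulerSeq.derLogRes k _ _ h (ψ W₂ δ)) ∧
      -- `φ` maps `α` to `α T ^ d T ∂_T`
      (∀ (W : EulerSeq.OpensIn U)
          (α : EulerSeq.sections (d • D + EulerSeq.divisorW k D d) W.1)
          (W' : EulerSeq.OpensIn W.1) (P : EulerSeq.cyl k D W'.1),
        ((φ W α).1 W' P).1 = EulerSeq.rationalDer k d 0 α.1 P.1) ∧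
      -- each `δ` is uniquely of the form `T ^ d (σ + α T ∂_T)`, and `ψ` maps it to `σ`
      (∀ (W : EulerSeq.OpensIn U) (δ : EulerSeq.derCyl k D d W.1),
        (∃! σα : Derivation k X.functionField X.functionField × X.functionField,
          ∀ (W' : EulerSeq.OpensIn W.1) (P : EulerSeq.cyl k D W'.1),
            (δ.1 W' P).1 = EulerSeq.rationalDer k d σα.1 σα.2 P.1) ∧
        ∃ α : X.functionField, ∀ (W' : EulerSeq.OpensIn W.1) (P : EulerSeq.cyl k D W'.1),
          (δ.1 W' P).1 = EulerSeq.rationalDer k d (ψ W δ).1 α P.1) ∧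
      -- the sequence `0 → O_U(dD + W) → (π_* Θ_C)_d → Der_U(dD - log L) → 0` is exact: left exact
      -- on every open subset, and right exact on the affine open subsets, which form a basis
      (∀ W : EulerSeq.OpensIn U, Function.Injective (φ W)) ∧
      (∀ W : EulerSeq.OpensIn U, Function.Exact (φ W) (ψ W)) ∧
      (∀ W : EulerSeq.OpensIn U, IsAffineOpen W.1 → Function.Surjective (ψ W)) := by
  have : CompactSpace X := QuasiCompact.compactSpace_of_compactSpace (X ↘ Spec (.of k))
  refine ⟨fun W => EulerSeq.eulerHom D d W.1, fun W => EulerSeq.symbolHom D d W.1,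
    fun W₁ W₂ h α => ?_, fun W₁ W₂ h δ => ?_, fun W α => EulerSeq.isRational_eulerHom α,
    fun W δ => ⟨?_, EulerSeq.exists_isRational_symbolDer δ⟩,
    fun W => EulerSeq.eulerHom_injective, fun W => EulerSeq.exact_eulerHom_symbolHom,
    fun W hW => EulerSeq.symbolHom_surjective W.2.2 hW hD⟩
  · exact (EulerSeq.isRational_eulerHom _).eq ((EulerSeq.isRational_eulerHom α).res h)
  · obtain ⟨α, hα⟩ := EulerSeq.exists_isRational_symbolDer δ
    exact Subtype.ext (hα.res h).symbolDer_eq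
  · obtain ⟨σ, α, hα⟩ := EulerSeq.exists_isRational δ
    exact ⟨(σ, α), hα, fun σα h => Prod.ext (EulerSeq.IsRational.ext h hα).1
      (EulerSeq.IsRational.ext h hα).2⟩
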